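/- **HITS.** On a finite directed graph with nodes $v_1,\dots,v_N$, HITS starts with all authority scores $a_i^{(0)}$ and hub scores $h_i^{(0)}$ equal to $1$ and, in iteration $t=1,2,\dots$, sets $a_i^{(t)}=\sum_{v_j\to v_i}h_j^{(t-1)}$ and then $h_i^{(t)}=\sum_{v_i\to v_j}a_j^{(t)}$, each vector being rescaled to Euclidean norm $1$. An undirected edge counts as a pair of opposite directed edges. **Convergence in rank.** Let $x^0,x^1,\dots$ be a sequence of score vectors and let $T_k^t=\{v_i : |\{v_j : x^t_j>x^t_i\}|<k\}$ be the set of weakly top $k$ nodes at step $t$. The sequence *converges on $h$ of the top $k$ ranks in $\tau$ steps* if $|\bigcap_{t\ge\tau}T_k^t|\ge h$. **The graph $\Gamma_{h,k,n}$.** Let $m=h-3$ and $\ell=\lceil\frac{k-h+1}{h-3}\rceil$. Let $\bar\Gamma_{m,n}$ be the graph with vertices $v_{-n},\dots,v_{n+m}$ in which $v_{-n},\dots,v_n$ form a path in this order and both ends $v_{-n}$ and $v_n$ are also joined to each of $v_{n+1},\dots,v_{n+m}$. Then $\Gamma_{h,k,n}$ is the disjoint union of $\bar\Gamma_{m,n}$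 and $\ell$ copies of $\bar\Gamma_{m,n}-v_0$. **Theorem.** Call integers $h,k,n$ admissible if $k>h>5$, $n$ is odd and $n\ge\max(3,\frac{k-h+2}{2})$. Put $N=\lceil\frac{k-2}{h-3}\rceil(2n+h-3)+1$ and $\bar t=\frac{3\ln(7/6)}{4e}\left(\frac{h-3}{2}\right)^{(n-1)/2}$. 1. For all admissible $h,k,n$ the undirected graph $\Gamma_{h,k,n}$ has exactly $N$ vertices, and on it HITS needs more than $\bar t$ steps to converge on $h$ of the top $k$ ranks: for no integer $0\le\tau\le\bar t$ does it converge on $h$ of the top $k$ ranks in $\tau$ steps. This holds for the sequence $(a^{(t)})_{t\ge0}$ of authority vectors, for the sequence $(h^{(t)})_{t\ge0}$ of hub vectors, and for the sequence $h^{(0)},a^{(1)},h^{(1)},a^{(2)},h^{(2)},\dots$ in which each half iteration counts as a step. 2. $\bar t=h^{\Omega(n)}$: there are absolute constants $c>0$ and $n_0$ such that $\bar t\ge h^{cn}$ for all admissible $h,k,n$ with $n\ge n_0$. 3. $\bar t=h^{\Omega(Nh/k)}$ for $N\ge 2k$, in the following two senses. (a) There is an absolute constant $c>0$ such that for all $h,k$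 there is an $N_0$ with $\bar t\ge h^{cNh/k}$ for all $n$ such that $h,k,n$ are admissible, $N\ge 2k$ and $N\ge N_0$. (b) For every $\varepsilon>0$ there are $c>0$ and $n_0$, depending only on $\varepsilon$, such that $\bar t\ge h^{cNh/k}$ for all admissible $h,k,n$ with $n\ge n_0$, $N\ge 2k$, and $k\ge(1+\varepsilon)h$ or $N\ge(2+\varepsilon)k$. -/

import Mathlib

namespace HITS

section Algorithm

variable {V : Type*} [Fintype V]

/-- Rescaling of a score vector to Euclidean norm one. -/
noncomputable def normalize (x : V → ℝ) : V → ℝ :=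
  ‖WithLp.toLp 2 x‖⁻¹ • x

open Classical in
/-- The pair (authority scores, hub scores) after `t` iterations of HITS on the directed graph
whose edges are the pairs `v → u` with `R v u`. All scores are initially `1`; an iteration
recomputes the authority scores from the hub scores, then the hub scores from the new
authority scores, and normalizes both. -/
noncomputable def scores (R : V → V → Prop) : ℕ → (V → ℝ) × (V → ℝ)
  | 0 => (fun _ => 1, fun _ => 1)
  | t + 1 =>
    let a := normalize (fun i => ∑ j with R j i, (scores R t).2 j)
    (a, normalize (fun i => ∑ j with R i j, a j))

/-- The authority vector after `t` iterations. -/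
noncomputable def authority (R : V → V → Prop) (t : ℕ) : V → ℝ := (scores R t).1

/-- The hub vector after `t` iterations. -/
noncomputable def hub (R : V → V → Prop) (t : ℕ) : V → ℝ := (scores R t).2

/-- The vectors computed by HITS in the order in which they are computed (half an iteration per
step): at time `2 s` the hub vector of iteration `s`, at time `2 s - 1` the authority vector of
iteration `s`. -/
noncomputable def halfSteps (R : V → V → Prop) (t : ℕ) : V → ℝ :=
  if Even t then hub R (t / 2) else authority R ((t + 1) / 2)

/-- The (weakly) top `k` nodes for the scores `x`: those with fewer than `k` nodes of strictly
larger score. -/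
def top (k : ℕ) (x : V → ℝ) : Set V := {i | {j | x i < x j}.ncard < k}

/-- The sequence `x` of score vectors converges on `h` of the top `k` ranks in `τ` steps. -/
def ConvergesIn (x : ℕ → V → ℝ) (h k τ : ℕ) : Prop :=
  h ≤ (⋂ t ≥ τ, top k (x t)).ncard

end Algorithm

section Graph

/-- The number `ℓ` of copies of the component without a middle vertex. -/
noncomputable def copies (h k : ℕ) : ℕ := ⌈((k : ℝ) - h + 1) / ((h : ℝ) - 3)⌉₊

/-- Vertices of `Γ_{h,k,n}`, with `m = h - 3`: the pair `(c, i)` is the vertex of index `i` in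
component `c`, where `-n ≤ i ≤ n + m` and `0 ≤ c ≤ ℓ`; only component `0` has a vertex of
index `0`. -/
noncomputable def gammaVertices (h k n : ℕ) : Finset (ℕ × ℤ) :=
  (Finset.range (copies h k + 1) ×ˢ Finset.Icc (-(n : ℤ)) ((n : ℤ) + ((h : ℤ) - 3))).filter
    fun p => p.2 = 0 → p.1 = 0

/-- Adjacency of indices inside a component: `-n, …, n` form a chain, and both ends `-n` and `n`
of the chain are joined to all indices above `n`. -/
def indexAdj (n : ℕ) (i j : ℤ) : Prop :=
  (|i| ≤ n ∧ |j| ≤ n ∧ |i - j| = 1) ∨ (|i| = n ∧ (n : ℤ) < j) ∨ (|j| = n ∧ (n : ℤ) < i)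

/-- The undirected graph `Γ_{h,k,n}`. -/
def Gamma (h k n : ℕ) : SimpleGraph (gammaVertices h k n) where
  Adj p q := p.1.1 = q.1.1 ∧ indexAdj n p.1.2 q.1.2
  symm := ⟨by
    rintro p q ⟨h₁, h₂⟩
    refine ⟨h₁.symm, ?_⟩
    rcases h₂ with ⟨a, b, c⟩ | h₂ | h₂
    · exact Or.inl ⟨b, a, by rwa [abs_sub_comm]⟩
    · exact Or.inr (Or.inr h₂)
    · exact Or.inr (Or.inl h₂)⟩
  loopless := ⟨by
    rintro p ⟨-, ⟨-, -, c⟩ | ⟨a, b⟩ | ⟨a, b⟩⟩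
    · simp at c
    · have := le_abs_self p.1.2
      omega
    · have := le_abs_self p.1.2
      omega⟩

end Graph

/-- The admissible parameters. -/
def Admissible (h k n : ℕ) : Prop :=
  5 < h ∧ h < k ∧ Odd n ∧ max 3 (((k : ℝ) - h + 2) / 2) ≤ n

/-- `N = ⌈(k-2)/(h-3)⌉ (2n+h-3) + 1`. -/
noncomputable def numVertices (h k n : ℕ) : ℕ :=
  ⌈((k : ℝ) - 2) / ((h : ℝ) - 3)⌉₊ * (2 * n + h - 3) + 1

/-- `3 ln(7/6) / (4e) * ((h-3)/2)^((n-1)/2)`. -/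
noncomputable def tBar (h n : ℕ) : ℝ :=
  3 * Real.log (7 / 6) / (4 * Real.exp 1) * (((h : ℝ) - 3) / 2) ^ (((n : ℝ) - 1) / 2)

end HITS

/-! On an undirected graph both halves of an iteration apply the same adjacency matrix, so up to
positive factors the score vectors are walk counts (`sameRay_hub`). By symmetry these depend only on
the component type and the distance from the middle (`walks_eq_radial`). Write `m = h - 3` and `n =
2 * r + 1`.

Two obstructions meet. The component containing the middle vertex has a strictly larger growth rate,
so in the long run its `2n + h - 2 ≥ k` vertices beat all others (`eventually_radial_lt`), and no
vertex outside it stays in the top `k`. Early on, however, the middle vertex is hardly felt at the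
chain ends: two steps multiply the count at an end by at least `2m + 1`, so the extra walks due to
the middle vertex, measured against the end, lose a factor `κ = 2/m` for every two edges they
travel. Up to time `tBar` the counts at the ends with and without the middle vertex therefore differ
by a factor below `4/3` (`radial_compare`, `radial_compare_tBar`). While this lasts, the vertices
beyond the chains in all components and the two ends in component `0`, at least `k` vertices by the
choice of `ℓ`, beat the inner chain of component `0` (`radial_succ_le`, `notMem_top_of_inner`). Only
the ends and the `m` further vertices of component `0` can then stay in the top `k`, and they number
`h - 1` (`not_convergesIn`).

The asymptotic claims follow from `rpow_le_tBar` and `Nh/k ≤ 9n + 4h` (`numVertices_mul_div_le`)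
once `h` is bounded linearly in `n`. -/

namespace HITS

/-! ### HITS on undirected graphs as walk counting -/

section Walks

variable {V : Type*} [Fintype V]

open Classical in
/-- The number of walks of length `s` starting in a given vertex. -/
noncomputable def walks (R : V → V → Prop) : ℕ → V → ℝ
  | 0 => fun _ => 1
  | s + 1 => fun i => ∑ j with R i j, walks R s j

lemma walks_pos {R : V → V → Prop} (hR : ∀ i, ∃ j, R i j) (s : ℕ) (i : V) : 0 < walks R s i := by
  induction s generalizing i with
  | zero => simp [walks]
  | succ s ih =>
    obtain ⟨j, hj⟩ := hR i
    exact Finset.sum_pos (fun j _ => ih j) ⟨j, by simpa using hj⟩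

/-- Two score vectors agree up to a positive factor. -/
def SameRay {V : Type*} (x y : V → ℝ) : Prop := ∃ c : ℝ, 0 < c ∧ x = c • y

lemma SameRay.lt_iff {V : Type*} {x y : V → ℝ} (h : SameRay x y) (i j : V) : x i < x j ↔ y i < y j := by
  obtain ⟨c, hc, rfl⟩ := h
  simp [hc]

lemma SameRay.top_eq {V : Type*} {x y : V → ℝ} (h : SameRay x y) (k : ℕ) : top k x = top k y := by
  simp only [top, h.lt_iff]

lemma sameRay_normalize [Nonempty V] {x y : V → ℝ} (h : SameRay x y) (hy : ∀ i, 0 < y i) :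
    SameRay (normalize x) y := by
  obtain ⟨c, hc, rfl⟩ := h
  have hn : 0 < ‖WithLp.toLp 2 (c • y)‖ := by
    rw [norm_pos_iff]
    intro h0
    have h1 := congrFun (congrArg WithLp.ofLp h0) (Classical.arbitrary V)
    have h2 := mul_pos hc (hy (Classical.arbitrary V))
    simp at h1
    rcases h1 with h1 | h1
    · exact hc.ne' h1
    · exact (hy _).ne' h1
  exact ⟨‖WithLp.toLp 2 (c • y)‖⁻¹ * c, by positivity, by rw [normalize, smul_smul]⟩

-- Symmetry turns the authority update into the hub update, and positive walk counts keep every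
-- normalization nonzero. The authority vector is shifted by one because the all-ones `authority R
-- 0` is never used.
open Classical in
lemma sameRay_hub [Nonempty V] {R : V → V → Prop} (hsymm : ∀ i j, R i j → R j i)
    (hR : ∀ i, ∃ j, R i j) (t : ℕ) :
    SameRay (hub R t) (walks R (2 * t)) ∧
      SameRay (authority R (t + 1)) (walks R (2 * t + 1)) := by
  have hc : ∀ i j, R i j ↔ R j i := fun i j => ⟨hsymm i j, hsymm j i⟩
  have step : ∀ (x : V → ℝ) (s : ℕ), SameRay x (walks R s) →
      SameRay (normalize (fun i => ∑ j with R i j, x j)) (walks R (s + 1)) := by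
    rintro x s ⟨c, hc, rfl⟩
    refine sameRay_normalize ⟨c, hc, ?_⟩ (walks_pos hR _)
    ext i
    simp [walks, Finset.mul_sum]
  have auth : ∀ t, SameRay (hub R t) (walks R (2 * t)) →
      SameRay (authority R (t + 1)) (walks R (2 * t + 1)) := by
    intro t ht
    have e : authority R (t + 1) =
        normalize (fun i => ∑ j with R i j, hub R t j) := by
      simp only [authority, scores, hub]
      congr 1
      ext i
      exact Finset.sum_congr (Finset.filter_congr fun j _ => hc j i) fun _ _ => rfl
    rw [e]
    exact step _ _ ht
  induction t with
  | zero =>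
    have h0 : SameRay (hub R 0) (walks R (2 * 0)) := ⟨1, one_pos, by simp [hub, scores, walks]⟩
    exact ⟨h0, auth 0 h0⟩
  | succ t ih =>
    have h0 : SameRay (hub R (t + 1)) (walks R (2 * (t + 1))) := step _ _ ih.2
    exact ⟨h0, auth _ h0⟩

lemma sameRay_halfSteps [Nonempty V] {R : V → V → Prop} (hsymm : ∀ i j, R i j → R j i)
    (hR : ∀ i, ∃ j, R i j) (t : ℕ) : SameRay (halfSteps R t) (walks R t) := by
  rcases Nat.even_or_odd' t with ⟨s, rfl | rfl⟩
  · simpa [halfSteps] using (sameRay_hub hsymm hR s).1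
  · have h2 : (2 * s + 1 + 1) / 2 = s + 1 := by omega
    simpa [halfSteps, h2] using (sameRay_hub hsymm hR s).2

end Walks

/-! ### Radial recurrences -/

/-- Walk counts in a component of `Γ`, as a function of the length of the walk and the distance
`j` of its start from the middle: `j ≤ n` stands for the vertices of index `±j`, and `j = n + 1` for
the `m` vertices of index above `n`. The factor `b` is `1` if the middle vertex is present, and `0`
if it is absent. -/
def radial (m n : ℕ) (b : ℝ) : ℕ → ℕ → ℝ
  | 0, _ => 1
  | s + 1, j =>
    if j = 0 then 2 * radial m n b s 1
    else if j = n + 1 then 2 * radial m n b s n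
    else (if j = n then m * radial m n b s (n + 1) else radial m n b s (j + 1)) +
      (if j = 1 then b * radial m n b s 0 else radial m n b s (j - 1))

section Recurrences

variable (m n : ℕ) (b : ℝ) (s : ℕ)

@[simp] lemma radial_zero (j : ℕ) : radial m n b 0 j = 1 := by simp [radial]

lemma radial_succ (j : ℕ) : radial m n b (s + 1) j =
    if j = 0 then 2 * radial m n b s 1
    else if j = n + 1 then 2 * radial m n b s n
    else (if j = n then m * radial m n b s (n + 1) else radial m n b s (j + 1)) +
      (if j = 1 then b * radial m n b s 0 else radial m n b s (j - 1)) := by rw [radial]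

lemma radial_succ_zero : radial m n b (s + 1) 0 = 2 * radial m n b s 1 := by simp [radial]

lemma radial_succ_top : radial m n b (s + 1) (n + 1) = 2 * radial m n b s n := by simp [radial]

lemma radial_succ_end (hn : 2 ≤ n) :
    radial m n b (s + 1) n = m * radial m n b s (n + 1) + radial m n b s (n - 1) := by
  simp [radial, show n ≠ 0 by omega, show n ≠ 1 by omega]

lemma radial_succ_one (hn : 2 ≤ n) :
    radial m n b (s + 1) 1 = radial m n b s 2 + b * radial m n b s 0 := by
  simp [radial, show 1 ≠ n by omega, show n ≠ 0 by omega]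

lemma radial_succ_inner {j : ℕ} (h1 : 1 ≤ j) (hj : j + 1 < n) :
    radial m n b (s + 1) (j + 1) = radial m n b s (j + 2) + radial m n b s j := by
  simp [radial, show j ≠ n by omega, show j + 1 ≠ n by omega, show j ≠ 0 by omega]

end Recurrences

/-! ### Two-step recurrences on the odd positions, which are closed under two steps -/

section TwoSteps

variable (m : ℕ) {r : ℕ} (b : ℝ) (s : ℕ)

lemma radial_two_end (hr : 1 ≤ r) :
    radial m (2 * r + 1) b (s + 2) (2 * r + 1) =
      (2 * m + 1) * radial m (2 * r + 1) b s (2 * r + 1) +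
        radial m (2 * r + 1) b s (2 * r - 1) := by
  obtain ⟨r, rfl⟩ : ∃ q, r = q + 1 := ⟨r - 1, by omega⟩
  rw [radial_succ_end _ _ _ _ (by omega), radial_succ_top,
    show 2 * (r + 1) + 1 - 1 = (2 * r + 1) + 1 by omega,
    radial_succ_inner _ _ _ _ (by omega) (by omega),
    show 2 * (r + 1) - 1 = 2 * r + 1 by omega, show 2 * (r + 1) + 1 = 2 * r + 1 + 2 by omega]
  ring

lemma radial_two_one (hr : 1 ≤ r) :
    radial m (2 * r + 1) b (s + 2) 1 =
      radial m (2 * r + 1) b s 3 + (1 + 2 * b) * radial m (2 * r + 1) b s 1 := by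
  rw [radial_succ_one _ _ _ _ (by omega), radial_succ_zero,
    show (2 : ℕ) = 1 + 1 from rfl, radial_succ_inner _ _ _ _ le_rfl (by omega)]
  ring

lemma radial_two_inner {l : ℕ} (hl : l + 1 < r) :
    radial m (2 * r + 1) b (s + 2) (2 * (l + 1) + 1) =
      radial m (2 * r + 1) b s (2 * l + 1) + 2 * radial m (2 * r + 1) b s (2 * (l + 1) + 1) +
        radial m (2 * r + 1) b s (2 * (l + 2) + 1) := by
  have h1 := radial_succ_inner m (2 * r + 1) b (s + 1) (j := 2 * l + 2) (by omega) (by omega)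
  have h2 := radial_succ_inner m (2 * r + 1) b s (j := 2 * l + 1) (by omega) (by omega)
  have h3 := radial_succ_inner m (2 * r + 1) b s (j := 2 * l + 3) (by omega) (by omega)
  simp only [show 2 * (l + 1) + 1 = 2 * l + 3 by ring, show 2 * (l + 2) + 1 = 2 * l + 5 by ring]
  simp only [add_assoc] at h1 h2 h3 ⊢
  norm_num at h1 h2 h3 ⊢
  linarith

end TwoSteps

/-- Induction with base cases `0` and `1` and steps of length two. -/
lemma two_step_rec {P : ℕ → Prop} (h0 : P 0) (h1 : P 1) (h : ∀ s, P s → P (s + 2)) (s : ℕ) :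
    P s := by
  induction s using Nat.twoStepInduction with
  | zero => exact h0
  | one => exact h1
  | more s ih _ => exact h s ih

/-! ### Short-time comparison of scores -/

section Bounds

variable {m n r : ℕ} {b : ℝ}

lemma radial_nonneg (hb : 0 ≤ b) (s j : ℕ) : 0 ≤ radial m n b s j := by
  induction s generalizing j with
  | zero => simp
  | succ s ih =>
    rw [radial]
    have h1 := ih 1
    have h2 := ih n
    have h3 := ih (n + 1)
    have h4 := ih (j + 1)
    have h5 := ih (j - 1)
    have h6 := ih 0
    split_ifs <;> positivity

lemma radial_one_end (hn : 2 ≤ n) : radial m n b 1 n = m + 1 := by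
  simp [radial_succ_end _ _ _ 0 hn]

lemma radial_one_le (hb : b ≤ 1) {j : ℕ} (hj : j < n) : radial m n b 1 j ≤ 2 := by
  rw [radial]
  simp only [radial_zero]
  split_ifs <;> first | omega | linarith

lemma radial_end_pos (hm : 3 ≤ m) (hr : 1 ≤ r) (hb : 0 ≤ b) (s : ℕ) :
    0 < radial m (2 * r + 1) b s (2 * r + 1) := by
  induction s using two_step_rec with
  | h0 => simp
  | h1 => rw [radial_one_end (by omega)]; positivity
  | h s ih =>
    rw [radial_two_end _ _ _ hr]
    have := radial_nonneg (m := m) (n := 2 * r + 1) hb s (2 * r - 1)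
    positivity

/-- Among the vertices at odd distance from the middle, the ends of the chain score best. -/
lemma radial_odd_le (hm : 3 ≤ m) (hr : 1 ≤ r) (hb : 0 ≤ b) (hb1 : b ≤ 1) (s : ℕ) :
    ∀ l ≤ r, radial m (2 * r + 1) b s (2 * l + 1) ≤ radial m (2 * r + 1) b s (2 * r + 1) := by
  have hm' : (3 : ℝ) ≤ m := by exact_mod_cast hm
  induction s using two_step_rec with
  | h0 => simp
  | h1 =>
    intro l hl
    rcases hl.eq_or_lt with rfl | hl
    · rfl
    · rw [radial_one_end (by omega)]
      have := radial_one_le (m := m) hb1 (show 2 * l + 1 < 2 * r + 1 by omega)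
      linarith
  | h s ih =>
    intro l hl
    rcases hl.eq_or_lt with rfl | hl
    · rfl
    have h0 := radial_nonneg (m := m) (n := 2 * r + 1) hb s
    rw [radial_two_end _ _ _ hr]
    -- The coefficients at every inner odd position sum to at most `4`, against at least `2m + 1 ≥
    -- 7` on the end itself.
    have hbig : 4 * radial m (2 * r + 1) b s (2 * r + 1) ≤
        (2 * m + 1) * radial m (2 * r + 1) b s (2 * r + 1) + radial m (2 * r + 1) b s (2 * r - 1) := by
      have := h0 (2 * r - 1)
      nlinarith [h0 (2 * r + 1)]
    refine le_trans ?_ hbig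
    rcases l with _ | l
    · rw [radial_two_one _ _ _ hr]
      have h1 := ih 0 (by omega)
      have h3 := ih 1 hr
      simp only [mul_zero, zero_add, mul_one] at h1 h3
      norm_num at h3
      nlinarith [h0 1]
    · rw [radial_two_inner _ _ _ hl]
      linarith [ih l (by omega), ih (l + 1) (by omega), ih (l + 2) (by omega)]

/-- With the middle vertex present, the inner vertices at odd distance from the middle score at
most half as much as the ends of the chain. -/
lemma radial_odd_le_half (hm : 3 ≤ m) (hr : 1 ≤ r) (s : ℕ) :
    ∀ l < r, radial m (2 * r + 1) 1 (s + 1) (2 * l + 1) ≤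
      1 / 2 * radial m (2 * r + 1) 1 (s + 1) (2 * r + 1) := by
  have hm' : (3 : ℝ) ≤ m := by exact_mod_cast hm
  induction s using two_step_rec with
  | h0 =>
    intro l hl
    rw [zero_add, radial_one_end (by omega)]
    have := radial_one_le (m := m) le_rfl (show 2 * l + 1 < 2 * r + 1 by omega)
    linarith
  | h1 =>
    intro l hl
    rw [show 1 + 1 = 0 + 2 from rfl, radial_two_end _ _ _ hr]
    rcases l with _ | l
    · rw [mul_zero, zero_add 1, radial_two_one _ _ _ hr]
      simp only [radial_zero]
      linarith
    · rw [radial_two_inner _ _ _ hl]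
      simp only [radial_zero]
      linarith
  | h s ih =>
    intro l hl
    have h0 := radial_nonneg (m := m) (n := 2 * r + 1) zero_le_one (s + 1)
    have hle := radial_odd_le (b := 1) hm hr zero_le_one le_rfl (s + 1)
    rw [show s + 2 + 1 = s + 1 + 2 by ring, radial_two_end _ _ _ hr]
    -- Inner values are at most half the end value and at most one neighbour is an end, so two steps
    -- give at most `5/2` of the end value, below `7/2`.
    have hbig : 7 * radial m (2 * r + 1) 1 (s + 1) (2 * r + 1) ≤
        (2 * m + 1) * radial m (2 * r + 1) 1 (s + 1) (2 * r + 1) +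
          radial m (2 * r + 1) 1 (s + 1) (2 * r - 1) := by
      have := h0 (2 * r - 1)
      nlinarith [h0 (2 * r + 1)]
    refine le_trans ?_ (mul_le_mul_of_nonneg_left hbig (by norm_num))
    rcases l with _ | l
    · rw [mul_zero, zero_add 1, radial_two_one _ _ _ hr]
      have h1 := ih 0 hl
      have h3 := hle 1 hr
      rw [mul_zero, zero_add 1] at h1
      norm_num at h3
      linarith [h0 (2 * r + 1)]
    · rw [radial_two_inner _ _ _ hl]
      linarith [ih l (by omega), ih (l + 1) (by omega), hle (l + 2) (by omega), h0 (2 * r + 1)]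

/-- With the middle vertex present all degrees are at least two. -/
lemma two_mul_radial_le (hm : 1 ≤ m) (hn : 2 ≤ n) (s : ℕ) :
    ∀ j ≤ n + 1, 2 * radial m n 1 s j ≤ radial m n 1 (s + 1) j := by
  have hm' : (1 : ℝ) ≤ m := by exact_mod_cast hm
  induction s with
  | zero =>
    intro j hj
    rw [radial_succ]
    simp only [radial_zero]
    split_ifs <;> linarith
  | succ s ih =>
    intro j hj
    rw [radial_succ m n 1 (s + 1), radial_succ m n 1 s]
    have h1 := ih 1 (by omega)
    have h2 := ih n (by omega)
    have h3 := ih (n + 1) le_rfl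
    have h5 := ih (j - 1) (by omega)
    have h6 := ih 0 (by omega)
    split_ifs with c1 c2 c3
    · linarith
    · linarith
    · nlinarith
    · nlinarith
    · linarith [ih (j + 1) (by omega)]
    · linarith [ih (j + 1) (by omega)]

/-- Of the two odd neighbours, at least one is inner and contributes at most one half; the other
contributes at most one. -/
lemma radial_succ_even_le (hm : 3 ≤ m) (hr : 1 ≤ r) (s : ℕ) {l : ℕ} (hl : l ≤ r) :
    radial m (2 * r + 1) 1 (s + 2) (2 * l) ≤
      3 / 2 * radial m (2 * r + 1) 1 (s + 1) (2 * r + 1) := by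
  have hhalf := radial_odd_le_half hm hr s
  have hle := radial_odd_le (b := 1) hm hr zero_le_one le_rfl (s + 1)
  have h0 := radial_nonneg (m := m) (n := 2 * r + 1) zero_le_one (s + 1) (2 * r + 1)
  rcases l with _ | l
  · have := hhalf 0 hr
    rw [mul_zero, zero_add 1] at this
    rw [mul_zero, radial_succ_zero]
    linarith
  · rw [show 2 * (l + 1) = 2 * l + 1 + 1 by ring, radial_succ_inner _ _ _ _ (by omega) (by omega)]
    have h1 := hhalf l (by omega)
    have h2 := hle (l + 1) (by omega)
    rw [show 2 * (l + 1) + 1 = 2 * l + 1 + 2 by ring] at h2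
    linarith

/-- The end value at least doubles in each step, which turns the factor `3/2` into `3/4`. -/
lemma radial_even_le (hm : 3 ≤ m) (hr : 1 ≤ r) (s : ℕ) {l : ℕ} (hl : l ≤ r) :
    radial m (2 * r + 1) 1 (s + 1) (2 * l) ≤
      3 / 4 * radial m (2 * r + 1) 1 (s + 1) (2 * r + 1) := by
  have hm' : (3 : ℝ) ≤ m := by exact_mod_cast hm
  rcases s with _ | s
  · rw [zero_add, radial_one_end (by omega)]
    have := radial_one_le (m := m) le_rfl (show 2 * l < 2 * r + 1 by omega)
    linarith
  · have h1 := radial_succ_even_le hm hr s hl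
    have h2 := two_mul_radial_le (m := m) (n := 2 * r + 1) (by omega) (by omega) (s + 1)
      (2 * r + 1) (by omega)
    linarith

/-- With the middle vertex present, the next score of an inner vertex of the chain is at most
`3/2` times the present score of the ends. -/
lemma radial_succ_le (hm : 3 ≤ m) (hr : 1 ≤ r) (s : ℕ) {j : ℕ} (hj : j < 2 * r + 1) :
    radial m (2 * r + 1) 1 (s + 2) j ≤
      3 / 2 * radial m (2 * r + 1) 1 (s + 1) (2 * r + 1) := by
  rcases Nat.even_or_odd' j with ⟨l, rfl | rfl⟩
  · exact radial_succ_even_le hm hr s (by omega)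
  · rcases l with _ | l
    · have h2 := radial_even_le hm hr s hr
      have h0 := radial_even_le hm hr s (Nat.zero_le r)
      rw [mul_zero, zero_add 1, radial_succ_one _ _ _ _ (by omega)]
      norm_num at h2 h0
      linarith
    · have h0 := radial_even_le hm hr s (show l + 1 ≤ r by omega)
      have h2 := radial_even_le hm hr s (show l + 2 ≤ r by omega)
      rw [radial_succ_inner _ _ _ _ (by omega) (by omega),
        show 2 * (l + 1) + 2 = 2 * (l + 2) by ring]
      linarith

/-- Removing the middle vertex has little influence on the scores of the ends of the chain. -/
lemma radial_compare (hm : 3 ≤ m) (hr : 1 ≤ r) (q e : ℕ) (he : e ≤ 1) :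
    radial m (2 * r + 1) 1 (2 * q + e) (2 * r + 1) ≤
      (1 + (2 / (m : ℝ)) ^ (r - 1) / (2 * m + 1)) ^ q *
        radial m (2 * r + 1) 0 (2 * q + e) (2 * r + 1) := by
  have hm' : (3 : ℝ) ≤ m := by exact_mod_cast hm
  set κ : ℝ := 2 / (m : ℝ) with hκ
  set θ : ℝ := κ ^ (r - 1) / (2 * m + 1) with hθ
  have hκ0 : 0 < κ := by positivity
  have hκ1 : κ ≤ 1 := by rw [hκ, div_le_one (by linarith)]; linarith
  have hκm : κ * m = 2 := by rw [hκ]; field_simp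
  have hθ0 : 0 < θ := by positivity
  have hθm : θ * (2 * m + 1) = κ ^ (r - 1) := by rw [hθ]; field_simp
  -- The induction also carries the inner positions: the excess caused by the middle vertex,
  -- measured in units of the end value, is `κ ^ l` at position `2l + 1`. The value of `θ` is what
  -- the excess at `l = r - 1` adds to the end, relative to its growth.
  suffices H : radial m (2 * r + 1) 1 (2 * q + e) (2 * r + 1) ≤
      (1 + θ) ^ q * radial m (2 * r + 1) 0 (2 * q + e) (2 * r + 1) ∧
      ∀ l < r, radial m (2 * r + 1) 1 (2 * q + e) (2 * l + 1) ≤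
        (1 + θ) ^ q * (radial m (2 * r + 1) 0 (2 * q + e) (2 * l + 1) +
          κ ^ l * radial m (2 * r + 1) 0 (2 * q + e) (2 * r + 1)) from H.1
  induction q with
  | zero =>
    simp only [mul_zero, zero_add, pow_zero, one_mul]
    obtain rfl | rfl : e = 0 ∨ e = 1 := by omega
    · simp only [radial_zero, le_refl, mul_one, true_and]
      intro l _
      have := pow_pos hκ0 l
      linarith
    · rw [radial_one_end (by omega), radial_one_end (by omega)]
      refine ⟨le_rfl, fun l hl => ?_⟩
      rcases l with _ | l
      · rw [mul_zero, zero_add 1, radial_succ_one _ _ _ _ (by omega),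
          radial_succ_one _ _ _ _ (by omega)]
        simp only [radial_zero]
        linarith
      · rw [show 2 * (l + 1) + 1 = 2 * l + 2 + 1 by ring,
          radial_succ_inner _ _ _ _ (by omega) (by omega),
          radial_succ_inner _ _ _ _ (by omega) (by omega)]
        simp only [radial_zero]
        have := pow_pos hκ0 (l + 1)
        nlinarith
  | succ q ih =>
    rw [show 2 * (q + 1) + e = 2 * q + e + 2 by ring]
    set s := 2 * q + e
    obtain ⟨ih1, ih2⟩ := ih
    have h0 := radial_nonneg (m := m) (n := 2 * r + 1) le_rfl s
    have hle := radial_odd_le (b := 0) hm hr le_rfl zero_le_one s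
    have hnext := radial_two_end m 0 s hr
    have hP : 0 < (1 + θ) ^ q := by positivity
    set P := (1 + θ) ^ q
    set Y := radial m (2 * r + 1) 0 s with hY
    have hend : (2 * m + 1) * Y (2 * r + 1) ≤ radial m (2 * r + 1) 0 (s + 2) (2 * r + 1) := by
      rw [hnext]; linarith [h0 (2 * r - 1)]
    -- Allowing `l = r` spares a separate case for the position next to the end.
    have hih1 : ∀ l ≤ r, radial m (2 * r + 1) 1 s (2 * l + 1) ≤
        P * (Y (2 * l + 1) + κ ^ l * Y (2 * r + 1)) := by
      intro l hl
      rcases hl.eq_or_lt with rfl | hl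
      · refine ih1.trans (mul_le_mul_of_nonneg_left ?_ hP.le)
        have := mul_nonneg (pow_pos hκ0 l).le (h0 (2 * l + 1))
        linarith
      · exact ih2 l hl
    have h7 : 7 * Y (2 * r + 1) ≤ (2 * m + 1) * Y (2 * r + 1) :=
      mul_le_mul_of_nonneg_right (by linarith) (h0 _)
    constructor
    · have h1 := ih2 (r - 1) (by omega)
      rw [show 2 * (r - 1) + 1 = 2 * r - 1 by omega] at h1
      rw [radial_two_end _ _ _ hr]
      calc _ ≤ (2 * m + 1) * (P * Y (2 * r + 1)) +
            P * (Y (2 * r - 1) + κ ^ (r - 1) * Y (2 * r + 1)) := by gcongr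
        _ = P * (radial m (2 * r + 1) 0 (s + 2) (2 * r + 1) + θ * ((2 * m + 1) * Y (2 * r + 1))) := by
            rw [hnext, ← hθm]; ring
        _ ≤ P * (radial m (2 * r + 1) 0 (s + 2) (2 * r + 1) +
            θ * radial m (2 * r + 1) 0 (s + 2) (2 * r + 1)) := by gcongr
        _ = _ := by rw [pow_succ]; ring
    · intro l hl
      have hstep : radial m (2 * r + 1) 1 (s + 2) (2 * l + 1) ≤
          P * (radial m (2 * r + 1) 0 (s + 2) (2 * l + 1) +
            κ ^ l * radial m (2 * r + 1) 0 (s + 2) (2 * r + 1)) := by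
        rcases l with _ | l
        · have a1 := hih1 0 (by omega)
          have a3 := hih1 1 hr
          have b1 := hle 0 (by omega)
          rw [mul_zero, zero_add 1] at a1 b1 ⊢
          rw [radial_two_one _ _ _ hr, radial_two_one _ _ _ hr]
          norm_num at a1 a3 ⊢
          -- Here the middle vertex acts directly. The excess is at most `2 + κ + 3 ≤ 6` end values,
          -- within the growth factor `2m + 1 ≥ 7`.
          calc _ ≤ P * (Y 3 + κ * Y (2 * r + 1)) + (1 + 2) * (P * (Y 1 + Y (2 * r + 1))) := by
                linarith
            _ = P * (Y 3 + Y 1 + (2 * Y 1 + (κ + 3) * Y (2 * r + 1))) := by ring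
            _ ≤ _ := by
                refine mul_le_mul_of_nonneg_left ?_ hP.le
                have := mul_le_mul_of_nonneg_right hκ1 (h0 (2 * r + 1))
                simp only [← hY]
                linarith [h0 (2 * r + 1)]
        · have a0 := hih1 l (by omega)
          have a1 := hih1 (l + 1) (by omega)
          have a2 := hih1 (l + 2) (by omega)
          rw [radial_two_inner _ _ _ hl, radial_two_inner _ _ _ hl]
          calc _ ≤ P * (Y (2 * l + 1) + κ ^ l * Y (2 * r + 1)) +
                2 * (P * (Y (2 * (l + 1) + 1) + κ ^ (l + 1) * Y (2 * r + 1))) +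
                P * (Y (2 * (l + 2) + 1) + κ ^ (l + 2) * Y (2 * r + 1)) := by linarith
            _ = P * (Y (2 * l + 1) + 2 * Y (2 * (l + 1) + 1) + Y (2 * (l + 2) + 1) +
                κ ^ l * ((1 + 2 * κ + κ * κ) * Y (2 * r + 1))) := by ring
            _ ≤ P * (Y (2 * l + 1) + 2 * Y (2 * (l + 1) + 1) + Y (2 * (l + 2) + 1) +
                κ ^ l * (κ * ((2 * m + 1) * Y (2 * r + 1)))) := by
                refine mul_le_mul_of_nonneg_left (add_le_add_right
                  (mul_le_mul_of_nonneg_left ?_ (pow_pos hκ0 l).le) _) hP.le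
                rw [← mul_assoc κ]
                refine mul_le_mul_of_nonneg_right ?_ (h0 _)
                -- Since `κ * m = 2`, the right side is `4 + κ`, while `1 + 2κ + κ² ≤ 4`.
                nlinarith
            _ ≤ P * (Y (2 * l + 1) + 2 * Y (2 * (l + 1) + 1) + Y (2 * (l + 2) + 1) +
                κ ^ l * (κ * radial m (2 * r + 1) 0 (s + 2) (2 * r + 1))) := by gcongr
            _ = _ := by ring
      refine hstep.trans (mul_le_mul_of_nonneg_right ?_ ?_)
      · rw [pow_succ]; nlinarith
      · have := radial_nonneg (m := m) (n := 2 * r + 1) le_rfl (s + 2)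
        have h1 := this (2 * l + 1)
        have h2 := this (2 * r + 1)
        positivity

end Bounds

/-! ### From the graph to the radial recurrences; vertex counts -/

section GraphWalks

variable {h k n : ℕ}

lemma mem_gammaVertices {c : ℕ} {i : ℤ} :
    (c, i) ∈ gammaVertices h k n ↔
      c ≤ copies h k ∧ -(n : ℤ) ≤ i ∧ i ≤ n + ((h : ℤ) - 3) ∧ (i = 0 → c = 0) := by
  simp [gammaVertices, and_assoc]

-- Neighbours lie in one component, so the sum can be taken over integer indices, where membership
-- is linear arithmetic.
open Classical in
lemma sum_neighbors (p : gammaVertices h k n) (S : Finset ℤ)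
    (hS : ∀ i, i ∈ S ↔ indexAdj n p.1.2 i ∧ (p.1.1, i) ∈ gammaVertices h k n) (φ : ℤ → ℝ)
    (F : gammaVertices h k n → ℝ) (hF : ∀ q : gammaVertices h k n, q.1.1 = p.1.1 → F q = φ q.1.2) :
    ∑ q with (Gamma h k n).Adj p q, F q = ∑ i ∈ S, φ i := by
  refine Finset.sum_bij' (fun q _ => q.1.2)
    (fun i hi => ⟨(p.1.1, i), ((hS i).1 hi).2⟩) ?_ ?_ ?_ ?_ ?_
  · rintro ⟨⟨c, i⟩, hq⟩ hadj
    replace hadj := (Finset.mem_filter.1 hadj).2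
    rw [hS]
    refine ⟨hadj.2, ?_⟩
    rwa [show p.1.1 = c from hadj.1]
  · intro i hi
    exact Finset.mem_filter.2 ⟨Finset.mem_univ _, rfl, ((hS i).1 hi).1⟩
  · rintro ⟨⟨c, i⟩, hq⟩ hadj
    replace hadj := (Finset.mem_filter.1 hadj).2
    simp [show p.1.1 = c from hadj.1]
  · intro i hi
    rfl
  · intro q hq
    exact hF q (Finset.mem_filter.1 hq).2.1.symm

/-- The distance from the middle of the vertices of index `i`, in the sense of `radial`. -/
def position (n : ℕ) (i : ℤ) : ℕ := if (n : ℤ) < i then n + 1 else i.natAbs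

lemma walks_eq_radial (hh : 4 ≤ h) (hn : 2 ≤ n) (s : ℕ) (p : gammaVertices h k n) :
    walks (Gamma h k n).Adj s p =
      radial (h - 3) n (if p.1.1 = 0 then 1 else 0) s (position n p.1.2) := by
  classical
  induction s generalizing p with
  | zero => simp [walks]
  | succ s ih =>
    set f := radial (h - 3) n (if p.1.1 = 0 then 1 else 0) s with hf
    have hF : ∀ q : gammaVertices h k n, q.1.1 = p.1.1 →
        walks (Gamma h k n).Adj s q = f (position n q.1.2) := by
      intro q hq
      rw [ih, hq]
    have hsum := fun S hS => sum_neighbors p S hS (fun i => f (position n i)) _ hF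
    have hval : walks (Gamma h k n).Adj (s + 1) p =
      ∑ q with (Gamma h k n).Adj p q, walks (Gamma h k n).Adj s q := by
      rw [walks]
    rw [hval]
    obtain ⟨⟨c, i⟩, hp⟩ := p
    obtain ⟨hc, hi1, hi2, hi0⟩ := mem_gammaVertices.1 hp
    simp only at hsum hf ⊢
    have hpos : ∀ j : ℤ, |j| ≤ n → position n j = j.natAbs := by
      intro j hj
      have := le_abs_self j
      rw [position, if_neg (by omega)]
    by_cases hin : (n : ℤ) < i
    · rw [hsum {-(n : ℤ), (n : ℤ)}, Finset.sum_pair (by omega), hpos _ (by simp), hpos _ (by simp),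
        position, if_pos hin, radial_succ_top]
      · simp [hf]; ring
      · intro j
        rw [mem_gammaVertices]
        simp only [indexAdj, Finset.mem_insert, Finset.mem_singleton]
        rcases abs_cases i with hi | hi <;> rcases abs_cases j with hj | hj <;>
          rcases abs_cases (i - j) with hij | hij <;> omega
    by_cases hend : |i| = n
    -- The sign `σ` treats both ends of the chain at once.
    · have hS : ∀ σ : ℤ, σ = 1 ∨ σ = -1 → i = σ * n → ∀ j,
          j ∈ insert (σ * (n - 1)) (Finset.Ioc (n : ℤ) (n + ((h : ℤ) - 3))) ↔
            indexAdj n i j ∧ (c, j) ∈ gammaVertices h k n := by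
        intro σ hσ hi j
        rw [mem_gammaVertices]
        simp only [indexAdj, Finset.mem_insert, Finset.mem_Ioc]
        rcases hσ with rfl | rfl <;> rcases abs_cases i with hi' | hi' <;>
          rcases abs_cases j with hj | hj <;>
          rcases abs_cases (i - j) with hij | hij <;> omega
      obtain ⟨σ, hσ, hiσ⟩ : ∃ σ : ℤ, (σ = 1 ∨ σ = -1) ∧ i = σ * n := by
        rcases abs_cases i with hi' | hi'
        · exact ⟨1, Or.inl rfl, by omega⟩
        · exact ⟨-1, Or.inr rfl, by omega⟩
      have habs : |σ * ((n : ℤ) - 1)| ≤ n := by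
        rcases hσ with rfl | rfl <;> rw [abs_le] <;> constructor <;> omega
      have hnat : (σ * ((n : ℤ) - 1)).natAbs = n - 1 := by rcases hσ with rfl | rfl <;> omega
      rw [hsum _ (hS σ hσ hiσ), Finset.sum_insert, hpos _ habs, hnat, hpos i hend.le,
        show i.natAbs = n by rcases abs_cases i with hi' | hi' <;> omega, radial_succ_end _ _ _ _ hn]
      · have : ∀ j ∈ Finset.Ioc (n : ℤ) (n + ((h : ℤ) - 3)), f (position n j) = f (n + 1) := by
          intro j hj
          rw [position, if_pos (Finset.mem_Ioc.1 hj).1]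
        rw [Finset.sum_congr rfl this, Finset.sum_const, Int.card_Ioc, nsmul_eq_mul,
          show ((n : ℤ) + ((h : ℤ) - 3) - n).toNat = h - 3 by omega, hf]
        ring
      · rw [Finset.mem_Ioc]
        have := le_abs_self (σ * ((n : ℤ) - 1))
        omega
    · have hlt : |i| < n := by
        rcases abs_cases i with hi' | hi' <;> omega
      rw [hpos i hlt.le]
      -- The filter drops index `0` outside component `0`; this is the factor `b` of `radial`.
      rw [hsum (({i - 1, i + 1} : Finset ℤ).filter fun j => j = 0 → c = 0)]
      · rw [Finset.sum_filter, Finset.sum_pair (by omega), hpos (i - 1), hpos (i + 1)]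
        · by_cases hz : i = 0
          · subst hz
            simp [hi0, radial_succ_zero, hf]
            ring
          by_cases h1 : i = 1
          · subst h1
            rw [show (1 : ℤ).natAbs = 1 from rfl, radial_succ_one _ _ _ _ hn]
            by_cases hc0 : c = 0 <;> simp [hc0, hf]
            ring
          by_cases h1' : i = -1
          · subst h1'
            rw [show (-1 : ℤ).natAbs = 1 from rfl, radial_succ_one _ _ _ _ hn]
            by_cases hc0 : c = 0 <;> simp [hc0, hf]
          rw [if_pos (by omega), if_pos (by omega)]
          rcases lt_or_gt_of_ne hz with hneg | hneg
          · obtain ⟨a, ha⟩ : ∃ a : ℕ, i = -((a : ℤ) + 1) := ⟨(-i - 1).toNat, by omega⟩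
            rw [show i.natAbs = a + 1 by omega, show (i - 1).natAbs = a + 2 by omega,
              show (i + 1).natAbs = a by omega, radial_succ_inner _ _ _ _ (by omega) ?_]
            rw [abs_of_neg hneg] at hlt
            omega
          · obtain ⟨a, ha⟩ : ∃ a : ℕ, i = (a : ℤ) + 1 := ⟨(i - 1).toNat, by omega⟩
            rw [show i.natAbs = a + 1 by omega, show (i - 1).natAbs = a by omega,
              show (i + 1).natAbs = a + 2 by omega, radial_succ_inner _ _ _ _ (by omega) ?_,
              add_comm]
            rw [abs_of_pos hneg] at hlt
            omega
        · rw [abs_le] at *; rw [abs_lt] at hlt; omega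
        · rw [abs_le]; rw [abs_lt] at hlt; omega
      · intro j
        rw [mem_gammaVertices]
        simp only [indexAdj, Finset.mem_filter, Finset.mem_insert, Finset.mem_singleton]
        rcases abs_cases i with hi' | hi' <;> rcases abs_cases j with hj | hj <;>
          rcases abs_cases (i - j) with hij | hij <;> omega

lemma exists_adj (hh : 4 ≤ h) (hn : 3 ≤ n) (p : gammaVertices h k n) :
    ∃ q, (Gamma h k n).Adj p q := by
  obtain ⟨⟨c, i⟩, hp⟩ := p
  obtain ⟨hc, hi1, hi2, hi0⟩ := mem_gammaVertices.1 hp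
  obtain ⟨j, hj, hj'⟩ : ∃ j, indexAdj n i j ∧ (c, j) ∈ gammaVertices h k n := by
    by_cases hin : (n : ℤ) < i
    · refine ⟨n, Or.inr (Or.inr ⟨by simp, hin⟩), mem_gammaVertices.2 ⟨hc, ?_, ?_, ?_⟩⟩ <;> omega
    by_cases hi : 1 ≤ i ∧ i < n ∨ i = -n ∨ i = 0
    · refine ⟨i + 1, Or.inl ⟨?_, ?_, by simp⟩, mem_gammaVertices.2 ⟨hc, ?_, ?_, ?_⟩⟩
      · rw [abs_le]; omega
      · rw [abs_le]; omega
      all_goals omega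
    by_cases hi' : i = n
    · refine ⟨n + 1, Or.inr (Or.inl ⟨by simp [hi'], by omega⟩),
        mem_gammaVertices.2 ⟨hc, ?_, ?_, ?_⟩⟩ <;> omega
    · refine ⟨i - 1, Or.inl ⟨?_, ?_, by simp⟩, mem_gammaVertices.2 ⟨hc, ?_, ?_, ?_⟩⟩
      · rw [abs_le]; omega
      · rw [abs_le]; omega
      all_goals omega
  exact ⟨⟨(c, j), hj'⟩, rfl, hj⟩

lemma copies_succ (hh : 4 ≤ h) (hk : h ≤ k) :
    ⌈((k : ℝ) - 2) / ((h : ℝ) - 3)⌉₊ = copies h k + 1 := by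
  have hh' : (4 : ℝ) ≤ h := by exact_mod_cast hh
  have hk' : (h : ℝ) ≤ k := by exact_mod_cast hk
  have h0 : (0 : ℝ) < (h : ℝ) - 3 := by linarith
  have : ((k : ℝ) - 2) / ((h : ℝ) - 3) = ((k : ℝ) - h + 1) / ((h : ℝ) - 3) + 1 := by
    field_simp
    ring
  rw [this, copies, Nat.ceil_add_one]
  apply div_nonneg <;> linarith

/-- This is what `ℓ` is chosen for: `(ℓ + 1)(h - 3) + 2 ≥ k`, the count needed in
`notMem_top_of_inner`. -/
lemma le_copies_mul (hh : 4 ≤ h) : k + 1 ≤ copies h k * (h - 3) + h := by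
  have hh' : (4 : ℝ) ≤ h := by exact_mod_cast hh
  have h0 : (0 : ℝ) < (h : ℝ) - 3 := by linarith
  have h1 := Nat.le_ceil (((k : ℝ) - h + 1) / ((h : ℝ) - 3))
  rw [div_le_iff₀ h0] at h1
  have h2 : ((h - 3 : ℕ) : ℝ) = (h : ℝ) - 3 := by push_cast [show 3 ≤ h by omega]; ring
  have h3 : ((k + 1 : ℕ) : ℝ) ≤ ((copies h k * (h - 3) + h : ℕ) : ℝ) := by
    push_cast [h2]
    rw [copies]
    linarith
  exact_mod_cast h3

lemma card_gammaVertices (hh : 4 ≤ h) (hk : h ≤ k) :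
    Fintype.card (gammaVertices h k n) = numVertices h k n := by
  rw [Fintype.card_coe, numVertices, copies_succ hh hk]
  have e : gammaVertices h k n = insert (0, 0) (Finset.range (copies h k + 1) ×ˢ
      (Finset.Icc (-(n : ℤ)) ((n : ℤ) + ((h : ℤ) - 3))).erase 0) := by
    ext ⟨c, i⟩
    rw [mem_gammaVertices]
    simp only [Finset.mem_insert, Prod.mk.injEq, Finset.mem_product, Finset.mem_range,
      Finset.mem_erase, Finset.mem_Icc]
    omega
  rw [e, Finset.card_insert_of_notMem (by simp), Finset.card_product, Finset.card_range,
    Finset.card_erase_of_mem (by rw [Finset.mem_Icc]; omega), Int.card_Icc]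
  congr 2
  omega

end GraphWalks

/-! ### Long-run growth rates -/

section Asymptotics

open Real Filter Topology

variable {m n : ℕ}

lemma sinh_succ_add_pred {θ : ℝ} (hn : 1 ≤ n) :
    sinh ((n + 1 : ℕ) * θ) + sinh ((n - 1 : ℕ) * θ) = 2 * cosh θ * sinh (n * θ) := by
  have h1 : ((n + 1 : ℕ) : ℝ) * θ = n * θ + θ := by push_cast; ring
  have h2 : ((n - 1 : ℕ) : ℝ) * θ = n * θ - θ := by push_cast [hn]; ring
  rw [h1, h2, sinh_add, sinh_sub]
  ring

lemma cosh_succ_add_pred {θ : ℝ} (hn : 1 ≤ n) :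
    cosh ((n + 1 : ℕ) * θ) + cosh ((n - 1 : ℕ) * θ) = 2 * cosh θ * cosh (n * θ) := by
  have h1 : ((n + 1 : ℕ) : ℝ) * θ = n * θ + θ := by push_cast; ring
  have h2 : ((n - 1 : ℕ) : ℝ) * θ = n * θ - θ := by push_cast [hn]; ring
  rw [h1, h2, cosh_add, cosh_sub]
  ring

lemma cosh_half_sq_lt : cosh (1 / 2) ^ 2 < 3 / 2 := by
  have h1 : cosh (1 / 2) ≤ exp (1 / 8) := by
    have := cosh_le_exp_half_sq (1 / 2)
    norm_num at this ⊢
    exact this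
  have h2 : exp (1 / 8) ^ 8 = exp 1 := by
    rw [← exp_nat_mul]; norm_num
  have h3 : exp 1 < 3 := lt_trans exp_one_lt_d9 (by norm_num)
  by_contra! h
  have h4 : 3 / 2 ≤ exp (1 / 8) ^ 2 := h.trans (by gcongr)
  have h5 : (3 / 2 : ℝ) ^ 4 ≤ (exp (1 / 8) ^ 2) ^ 4 := by gcongr
  rw [← pow_mul] at h5
  norm_num [h2] at h5
  linarith

/-- The growth rate `2 cosh θ` of the walk counts without the middle vertex lies strictly below the
growth rate with the middle vertex, which is at least `2 cosh θ'`. -/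
lemma exists_growth_rates (hm : 3 ≤ m) (hn : 1 ≤ n) :
    ∃ θ θ' : ℝ, 0 < θ ∧ θ < θ' ∧
      2 * m * sinh (n * θ) = 2 * cosh θ * sinh ((n + 1 : ℕ) * θ) ∧
      2 * cosh θ' * cosh ((n + 1 : ℕ) * θ') ≤ 2 * m * cosh (n * θ') := by
  have hm' : (3 : ℝ) ≤ m := by exact_mod_cast hm
  have hn' : (1 : ℝ) ≤ n := by exact_mod_cast hn
  -- A zero of `G` is the condition at the chain end for `sinh (j * θ)` to extend to an eigenvector
  -- without the middle vertex. At `1/2`, `4 cosh² < 6 ≤ 2m` gives one sign; at `m`, `cosh m ≥ m`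
  -- gives the other.
  let G : ℝ → ℝ := fun θ => 2 * cosh θ * sinh ((n + 1 : ℕ) * θ) - 2 * m * sinh (n * θ)
  have hG : Continuous G := by fun_prop
  have hG1 : G (1 / 2) ≤ 0 := by
    have h1 := sinh_succ_add_pred (θ := 1 / 2) hn
    have h2 : 0 ≤ sinh ((n - 1 : ℕ) * (1 / 2)) := sinh_nonneg_iff.2 (by positivity)
    have h3 : 0 ≤ sinh ((n : ℝ) * (1 / 2)) := sinh_nonneg_iff.2 (by positivity)
    have h4 := cosh_half_sq_lt
    have hc := cosh_pos (1 / 2)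
    have h5 : 2 * cosh (1 / 2) * sinh ((n + 1 : ℕ) * (1 / 2)) ≤
        2 * cosh (1 / 2) * (2 * cosh (1 / 2) * sinh (n * (1 / 2))) := by
      apply mul_le_mul_of_nonneg_left _ (by positivity)
      linarith
    have h6 : 4 * cosh (1 / 2) ^ 2 * sinh ((n : ℝ) * (1 / 2)) ≤ 2 * m * sinh (n * (1 / 2)) :=
      mul_le_mul_of_nonneg_right (by linarith) h3
    simp only [G]
    linarith
  have hG2 : 0 ≤ G m := by
    have h1 : (m : ℝ) ≤ cosh m := by
      have := add_one_le_exp (m : ℝ)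
      have h2 := quadratic_le_exp_of_nonneg (show (0 : ℝ) ≤ m by positivity)
      rw [cosh_eq]
      have := exp_pos (-(m : ℝ))
      nlinarith
    have h2 : sinh (n * m) ≤ sinh ((n + 1 : ℕ) * m) := sinh_le_sinh.2 (by push_cast; nlinarith)
    have h3 : 0 ≤ sinh ((n : ℝ) * m) := sinh_nonneg_iff.2 (by positivity)
    have h4 := mul_le_mul h1 h2 h3 (cosh_pos _).le
    simp only [G]
    linarith
  obtain ⟨θ, ⟨hθ1, -⟩, hθ⟩ := intermediate_value_Icc (show (1 / 2 : ℝ) ≤ m by linarith)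
    hG.continuousOn ⟨hG1, hG2⟩
  have hθ0 : 0 < θ := by linarith
  let F : ℝ → ℝ := fun θ => 2 * m * cosh (n * θ) - 2 * cosh θ * cosh ((n + 1 : ℕ) * θ)
  have hF : Continuous F := by fun_prop
  -- At the zero of `G`, the addition formula leaves `F θ * sinh (n * θ) = 2 * cosh θ * sinh θ > 0`.
  -- This strict slack survives a small increase of `θ`.
  have hFθ : 0 < F θ := by
    have h3 : 0 < sinh ((n : ℝ) * θ) := sinh_pos_iff.2 (by positivity)
    have h4 : sinh ((n + 1 : ℕ) * θ) * cosh (n * θ) - cosh ((n + 1 : ℕ) * θ) * sinh (n * θ)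
        = sinh θ := by
      rw [← sinh_sub]
      congr 1
      push_cast
      ring
    have h5 : 0 < sinh θ := sinh_pos_iff.2 hθ0
    have h6 : F θ * sinh (n * θ) = 2 * cosh θ * sinh θ := by
      simp only [F, G] at hθ ⊢
      rw [← h4]
      linear_combination (-cosh (n * θ)) * hθ
    have h7 : 0 < F θ * sinh (n * θ) := by
      rw [h6]
      have := cosh_pos θ
      positivity
    exact pos_of_mul_pos_left h7 h3.le
  have hev : ∀ᶠ x in 𝓝[>] θ, 0 < F x :=
    nhdsWithin_le_nhds (hF.continuousAt.eventually (lt_mem_nhds hFθ))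
  obtain ⟨θ', hθ', hlt⟩ := (hev.and self_mem_nhdsWithin).exists
  refine ⟨θ, θ', hθ0, hlt, ?_, ?_⟩
  · simp only [G] at hθ; linarith
  · simp only [F] at hθ'; linarith

/-- Compares a positive vector with the all-ones initial vector in both directions. The index starts
at `1` because `sinh` vanishes at `0`. -/
lemma exists_mul_ge_one {p : ℕ → ℝ} (N : ℕ) (hp : ∀ j, 1 ≤ j → j ≤ N → 0 < p j) :
    ∃ C > 0, ∀ j, 1 ≤ j → j ≤ N → 1 ≤ C * p j ∧ p j ≤ C := by
  induction N with
  | zero => exact ⟨1, one_pos, fun j _ _ => by omega⟩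
  | succ N ih =>
    obtain ⟨C, hC, h⟩ := ih fun j h1 h2 => hp j h1 (by omega)
    have h0 := hp (N + 1) (by omega) le_rfl
    refine ⟨C + p (N + 1) + (p (N + 1))⁻¹, by positivity, fun j h1 h2 => ?_⟩
    have hinv : 0 < (p (N + 1))⁻¹ := by positivity
    rcases h2.eq_or_lt with rfl | h2
    · refine ⟨?_, by linarith⟩
      have : (p (N + 1))⁻¹ * p (N + 1) = 1 := inv_mul_cancel₀ h0.ne'
      nlinarith
    · obtain ⟨h3, h4⟩ := h j h1 (by omega)
      have := hp j h1 (by omega)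
      exact ⟨by nlinarith, by linarith⟩

/-- The vector `p` is a positive eigenvector of the recurrence with eigenvalue `2 cosh θ`; `sinh` is
chosen since it vanishes at the missing middle vertex. A multiple of `p` dominates the initial
vector, hence all later ones. -/
lemma radial_zero_le_pow {θ : ℝ} (hn : 2 ≤ n) (hθ : 0 < θ)
    (h : 2 * m * sinh (n * θ) = 2 * cosh θ * sinh ((n + 1 : ℕ) * θ)) :
    ∃ C > 0, ∀ s j, 1 ≤ j → j ≤ n + 1 → radial m n 0 s j ≤ C * (2 * cosh θ) ^ s := by
  have hc := cosh_pos θ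
  set lam := 2 * cosh θ with hlam
  have hl : 0 < lam := by positivity
  let p : ℕ → ℝ := fun j => if j = n + 1 then 2 * sinh (n * θ) / lam else sinh (j * θ)
  have hpos : ∀ j, 1 ≤ j → j ≤ n + 1 → 0 < p j := by
    intro j h1 h2
    have h3 : 0 < sinh ((n : ℝ) * θ) := sinh_pos_iff.2 (by positivity)
    have h4 : 0 < sinh ((j : ℝ) * θ) := sinh_pos_iff.2 (by positivity)
    simp only [p]
    split_ifs <;> positivity
  obtain ⟨C, hC, hCp⟩ := exists_mul_ge_one (n + 1) hpos
  have key : ∀ s j, 1 ≤ j → j ≤ n + 1 → radial m n 0 s j ≤ C * lam ^ s * p j := by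
    intro s
    induction s with
    | zero => intro j h1 h2; simpa using (hCp j h1 h2).1
    | succ s ih =>
      intro j h1 h2
      have hpn : p n = sinh (n * θ) := by simp [p]
      have htop : p (n + 1) = 2 * sinh (n * θ) / lam := by simp [p]
      have hCs : 0 ≤ C * lam ^ s := by positivity
      rcases h2.eq_or_lt with rfl | h2
      · rw [radial_succ_top, htop, pow_succ]
        have := ih n (by omega) (by omega)
        rw [hpn] at this
        calc _ ≤ 2 * (C * lam ^ s * sinh (n * θ)) := by linarith
          _ = _ := by field_simp
      have h2' : j ≤ n := by omega
      rcases h2'.eq_or_lt with rfl | h2'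
      · rw [radial_succ_end _ _ _ _ hn, hpn]
        have a1 := ih (j + 1) (by omega) le_rfl
        have a2 := ih (j - 1) (by omega) (by omega)
        have hpred : p (j - 1) = sinh ((j - 1 : ℕ) * θ) := by
          simp only [p]; rw [if_neg (by omega)]
        have hs := sinh_succ_add_pred (n := j) (θ := θ) (by omega)
        rw [htop] at a1
        rw [hpred] at a2
        have hm0 : (0 : ℝ) ≤ m := by positivity
        have e : m * (2 * sinh (j * θ) / lam) = sinh ((j + 1 : ℕ) * θ) := by
          rw [mul_div_assoc', div_eq_iff hl.ne']
          linarith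
        calc _ ≤ m * (C * lam ^ s * (2 * sinh (j * θ) / lam)) +
              C * lam ^ s * sinh ((j - 1 : ℕ) * θ) := by gcongr
          _ = C * lam ^ s * (m * (2 * sinh (j * θ) / lam) + sinh ((j - 1 : ℕ) * θ)) := by ring
          _ = _ := by rw [e, hs, pow_succ]; ring
      · obtain ⟨i, rfl⟩ : ∃ i, j = i + 1 := ⟨j - 1, by omega⟩
        have hp' : ∀ i ≤ n, p i = sinh (i * θ) := fun i hi => by
          simp only [p]; rw [if_neg (by omega)]
        have hs := sinh_succ_add_pred (n := i + 1) (θ := θ) (by omega)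
        have a1 := ih (i + 2) (by omega) (by omega)
        rw [hp' _ (by omega)] at a1
        rw [hp' _ (by omega), pow_succ]
        rcases Nat.eq_zero_or_pos i with rfl | hi
        · rw [zero_add 1, radial_succ_one _ _ _ _ hn]
          simp only [zero_add, Nat.sub_self, Nat.cast_zero, zero_mul, sinh_zero, add_zero] at hs a1 ⊢
          calc _ ≤ C * lam ^ s * sinh ((2 : ℕ) * θ) := a1
            _ = _ := by rw [show (2 : ℕ) = 1 + 1 from rfl, hs]; ring
        · rw [radial_succ_inner _ _ _ _ hi (by omega)]
          have a2 := ih i (by omega) (by omega)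
          rw [hp' _ (by omega)] at a2
          rw [Nat.add_sub_cancel] at hs
          calc _ ≤ C * lam ^ s * sinh ((i + 2 : ℕ) * θ) + C * lam ^ s * sinh (i * θ) := by linarith
            _ = C * lam ^ s * (sinh ((i + 1 + 1 : ℕ) * θ) + sinh (i * θ)) := by ring
            _ = _ := by rw [hs]; ring
  refine ⟨C * C, by positivity, fun s j h1 h2 => (key s j h1 h2).trans ?_⟩
  calc _ ≤ C * lam ^ s * C := by gcongr; exact (hCp j h1 h2).2
    _ = _ := by ring

/-- Now `cosh`, even about the middle vertex, gives a subsolution: equality holds everywhere except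
at the end of the chain, where the hypothesis gives the inequality. -/
lemma pow_le_radial_one {θ : ℝ} (hn : 2 ≤ n)
    (h : 2 * cosh θ * cosh ((n + 1 : ℕ) * θ) ≤ 2 * m * cosh (n * θ)) :
    ∃ c > 0, ∀ s j, j ≤ n + 1 → c * (2 * cosh θ) ^ s ≤ radial m n 1 s j := by
  have hc := cosh_pos θ
  set lam := 2 * cosh θ with hlam
  have hl : 0 < lam := by positivity
  let p : ℕ → ℝ := fun j => if j = n + 1 then 2 * cosh (n * θ) / lam else cosh (j * θ)
  have hpos : ∀ j, 0 < p j := by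
    intro j
    have h3 := cosh_pos ((n : ℝ) * θ)
    have h4 := cosh_pos ((j : ℝ) * θ)
    simp only [p]
    split_ifs <;> positivity
  -- The shift by one brings position `0` into the range.
  obtain ⟨C, hC, hCp⟩ := exists_mul_ge_one (p := fun j => p (j - 1)) (n + 2) fun j _ _ => hpos _
  replace hCp : ∀ j ≤ n + 1, 1 ≤ C * p j ∧ p j ≤ C := fun j hj => by
    simpa using hCp (j + 1) (by omega) (by omega)
  have key : ∀ s j, j ≤ n + 1 → C⁻¹ * lam ^ s * p j ≤ radial m n 1 s j := by
    intro s
    induction s with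
    | zero =>
      intro j h2
      rw [radial_zero, pow_zero, mul_one, inv_mul_le_iff₀ hC, mul_one]
      exact (hCp j h2).2
    | succ s ih =>
      intro j h2
      have hpn : p n = cosh (n * θ) := by simp [p]
      have htop : p (n + 1) = 2 * cosh (n * θ) / lam := by simp [p]
      have hp' : ∀ i ≤ n, p i = cosh (i * θ) := fun i hi => by
        simp only [p]; rw [if_neg (by omega)]
      have hCs : 0 ≤ C⁻¹ * lam ^ s := by positivity
      rcases h2.eq_or_lt with rfl | h2
      · rw [radial_succ_top, htop, pow_succ]
        have := ih n (by omega)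
        rw [hpn] at this
        calc _ = 2 * (C⁻¹ * lam ^ s * cosh (n * θ)) := by field_simp
          _ ≤ _ := by linarith
      have h2' : j ≤ n := by omega
      rcases h2'.eq_or_lt with rfl | h2'
      · rw [radial_succ_end _ _ _ _ hn, hpn]
        have a1 := ih (j + 1) le_rfl
        have a2 := ih (j - 1) (by omega)
        have hs := cosh_succ_add_pred (n := j) (θ := θ) (by omega)
        rw [htop] at a1
        rw [hp' _ (by omega)] at a2
        have hm0 : (0 : ℝ) ≤ m := by positivity
        have e : cosh ((j + 1 : ℕ) * θ) ≤ m * (2 * cosh (j * θ) / lam) := by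
          rw [mul_div_assoc', le_div_iff₀ hl]
          linarith
        calc _ = C⁻¹ * lam ^ s * (cosh ((j + 1 : ℕ) * θ) + cosh ((j - 1 : ℕ) * θ)) := by
              rw [hs, pow_succ]; ring
          _ ≤ C⁻¹ * lam ^ s * (m * (2 * cosh (j * θ) / lam) + cosh ((j - 1 : ℕ) * θ)) := by gcongr
          _ = m * (C⁻¹ * lam ^ s * (2 * cosh (j * θ) / lam)) +
              C⁻¹ * lam ^ s * cosh ((j - 1 : ℕ) * θ) := by ring
          _ ≤ _ := by gcongr
      rw [hp' _ (by omega), pow_succ]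
      rcases j with _ | i
      · have a1 := ih 1 (by omega)
        rw [hp' _ (by omega)] at a1
        rw [radial_succ_zero]
        norm_num at a1 ⊢
        calc _ = 2 * (C⁻¹ * lam ^ s * cosh θ) := by rw [hlam]; ring
          _ ≤ _ := by linarith
      · have hs := cosh_succ_add_pred (n := i + 1) (θ := θ) (by omega)
        have a1 := ih (i + 2) (by omega)
        have a2 := ih i (by omega)
        rw [hp' _ (by omega)] at a1 a2
        rw [Nat.add_sub_cancel] at hs
        have hr : radial m n 1 (s + 1) (i + 1) = radial m n 1 s (i + 2) + radial m n 1 s i := by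
          rcases Nat.eq_zero_or_pos i with rfl | hi
          · rw [zero_add 1, radial_succ_one _ _ _ _ hn, one_mul]
          · exact radial_succ_inner _ _ _ _ hi (by omega)
        rw [hr]
        calc _ = C⁻¹ * lam ^ s * (cosh ((i + 1 + 1 : ℕ) * θ) + cosh (i * θ)) := by rw [hs]; ring
          _ = C⁻¹ * lam ^ s * cosh ((i + 2 : ℕ) * θ) + C⁻¹ * lam ^ s * cosh (i * θ) := by ring
          _ ≤ _ := by linarith
  refine ⟨C⁻¹ * C⁻¹, by positivity, fun s j h2 => le_trans ?_ (key s j h2)⟩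
  have h1 := (hCp j h2).1
  have h3 : C⁻¹ ≤ p j := by rw [inv_le_iff_one_le_mul₀' hC]; exact h1
  calc _ = C⁻¹ * lam ^ s * C⁻¹ := by ring
    _ ≤ _ := by gcongr

/-- In the long run, all scores in the component with a middle vertex exceed all scores in the
components without. -/
lemma eventually_radial_lt (hm : 3 ≤ m) (hn : 2 ≤ n) :
    ∃ s₀, ∀ s ≥ s₀, ∀ i j, 1 ≤ i → i ≤ n + 1 → j ≤ n + 1 →
      radial m n 0 s i < radial m n 1 s j := by
  obtain ⟨θ, θ', hθ, hlt, h1, h2⟩ := exists_growth_rates hm (show 1 ≤ n by omega)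
  obtain ⟨C, hC, hE⟩ := radial_zero_le_pow hn hθ h1
  obtain ⟨c, hc, hD⟩ := pow_le_radial_one hn h2
  have hcosh : cosh θ < cosh θ' := by
    rw [cosh_lt_cosh, abs_of_pos hθ, abs_of_pos (hθ.trans hlt)]; exact hlt
  have hcθ := cosh_pos θ
  have hratio : 1 < (2 * cosh θ') / (2 * cosh θ) := by
    rw [one_lt_div (by positivity)]; linarith
  obtain ⟨s₀, hs₀⟩ := eventually_atTop.1
    ((tendsto_pow_atTop_atTop_of_one_lt hratio).eventually_gt_atTop (C / c))
  refine ⟨s₀, fun s hs i j hi hi' hj => ?_⟩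
  refine (hE s i hi hi').trans_lt (lt_of_lt_of_le ?_ (hD s j hj))
  have := hs₀ s hs
  rw [div_pow, div_lt_div_iff₀ hc (by positivity)] at this
  linarith

end Asymptotics

/-! ### The two obstructions and the lower bound -/

section SlowConvergence

variable {h k n r : ℕ}

lemma mul_pow_le_half_of_le_tBar {τ : ℕ} (hh : 5 < h) :
    (τ : ℝ) ≤ tBar h (2 * r + 1) →
      (τ : ℝ) * (2 / ((h - 3 : ℕ) : ℝ)) ^ r ≤ 1 / 2 := by
  intro hτ
  have hh' : (6 : ℝ) ≤ h := by exact_mod_cast hh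
  have hm : ((h - 3 : ℕ) : ℝ) = (h : ℝ) - 3 := by push_cast [show 3 ≤ h by omega]; ring
  have hx : (0 : ℝ) < ((h : ℝ) - 3) / 2 := by linarith
  have hexp : (((2 * r + 1 : ℕ) : ℝ) - 1) / 2 = r := by push_cast; ring
  rw [tBar, hexp, Real.rpow_natCast] at hτ
  have hC : 3 * Real.log (7 / 6) / (4 * Real.exp 1) ≤ 1 / 2 := by
    have h1 : Real.log (7 / 6) ≤ 7 / 6 - 1 := Real.log_le_sub_one_of_pos (by norm_num)
    have h2 : 1 ≤ Real.exp 1 := Real.one_le_exp zero_le_one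
    rw [div_le_iff₀ (by positivity)]
    linarith
  rw [hm, ← inv_div ((h : ℝ) - 3) 2, inv_pow, ← div_eq_mul_inv, div_le_iff₀ (by positivity)]
  exact hτ.trans (mul_le_mul_of_nonneg_right hC (by positivity))

/-- Up to time `tBar`, the scores of the ends of the chain hardly depend on the presence of the
middle vertex. -/
lemma radial_compare_tBar {τ q e : ℕ} (hh : 5 < h) (hr : 1 ≤ r) (hτ : (τ : ℝ) ≤ tBar h (2 * r + 1))
    (hq : q ≤ max τ 1) (he : e ≤ 1) :
    radial (h - 3) (2 * r + 1) 1 (2 * q + e) (2 * r + 1) <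
      4 / 3 * radial (h - 3) (2 * r + 1) 0 (2 * q + e) (2 * r + 1) := by
  have hm : 3 ≤ h - 3 := by omega
  have hη := mul_pow_le_half_of_le_tBar hh hτ
  have hcomp := radial_compare hm hr q e he
  have hpos := radial_end_pos hm hr le_rfl (2 * q + e)
  generalize h - 3 = m at *
  refine hcomp.trans_lt (mul_lt_mul_of_pos_right ?_ hpos)
  have hm' : (3 : ℝ) ≤ m := by exact_mod_cast hm
  have hκ1 : 2 / (m : ℝ) ≤ 1 := by rw [div_le_one (by linarith)]; linarith
  have h7 : (2 / (m : ℝ)) ^ (r - 1) / (2 * m + 1) ≤ 1 / 7 :=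
    div_le_div₀ zero_le_one (pow_le_one₀ (by positivity) hκ1) (by norm_num) (by linarith)
  -- For `τ = 0` the case `q = 1` is still allowed; a single factor is at most `8/7`.
  rcases Nat.lt_or_ge τ 1 with h0 | h0
  · obtain rfl | rfl : q = 0 ∨ q = 1 := by omega
    · norm_num
    · rw [pow_one]; linarith
  · have hqτ : (q : ℝ) ≤ τ := by exact_mod_cast (by omega : q ≤ τ)
    -- Because `1 / (2m + 1) ≤ 1 / (2m)`, which is a quarter of `2/m`.
    have h4 : (2 / (m : ℝ)) ^ (r - 1) / (2 * m + 1) ≤ (2 / (m : ℝ)) ^ r / 4 := by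
      obtain ⟨r, rfl⟩ : ∃ a, r = a + 1 := ⟨r - 1, by omega⟩
      rw [Nat.add_sub_cancel, pow_succ, mul_div_assoc, div_eq_mul_inv]
      refine mul_le_mul_of_nonneg_left ?_ (by positivity)
      rw [inv_eq_one_div, div_div, div_le_div_iff₀ (by positivity) (by positivity)]
      linarith
    calc (1 + (2 / (m : ℝ)) ^ (r - 1) / (2 * m + 1)) ^ q
        ≤ Real.exp ((2 / (m : ℝ)) ^ r / 4) ^ q := by
          gcongr
          linarith [Real.add_one_le_exp ((2 / (m : ℝ)) ^ r / 4)]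
      _ = Real.exp (q * ((2 / (m : ℝ)) ^ r / 4)) := by rw [← Real.exp_nat_mul]
      _ ≤ Real.exp (1 / 8) := by
          refine Real.exp_le_exp.2 ?_
          have : (q : ℝ) * (2 / (m : ℝ)) ^ r ≤ τ * (2 / (m : ℝ)) ^ r := by gcongr
          linarith
      _ < 4 / 3 := by
          have h2 : Real.exp (1 / 8) ^ 8 = Real.exp 1 := by
            rw [← Real.exp_nat_mul]; norm_num
          have h3 : Real.exp 1 < 3 := lt_trans Real.exp_one_lt_d9 (by norm_num)
          by_contra! h4
          have h5 : (4 / 3 : ℝ) ^ 8 ≤ Real.exp (1 / 8) ^ 8 := by gcongr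
          rw [h2] at h5
          norm_num at h5
          linarith

lemma card_le_ncard_of_subset {α : Type*} {G : Finset α} (T : Finset α) (hT : T ⊆ G) (S : Set G)
    (hS : ∀ q : G, q.1 ∈ T → q ∈ S) : T.card ≤ S.ncard := by
  classical
  have h1 : (T.subtype (· ∈ G)).card = T.card := by
    rw [Finset.card_subtype, Finset.filter_true_of_mem fun x hx => hT hx]
  rw [← h1, ← Set.ncard_coe_finset]
  exact Set.ncard_le_ncard (fun q hq => hS q (by simpa using hq)) (Set.toFinite _)

lemma ncard_le_card_of_subset {α : Type*} {G : Finset α} (T : Finset α) (S : Set G)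
    (hS : ∀ q ∈ S, q.1 ∈ T) : S.ncard ≤ T.card := by
  rw [← Set.ncard_coe_finset, ← Set.ncard_image_of_injective S Subtype.val_injective]
  refine Set.ncard_le_ncard ?_ (Set.toFinite _)
  rintro _ ⟨q, hq, rfl⟩
  exact hS q hq

/-- In the long run the vertices outside of component `0` are not among the top `k`. -/
lemma notMem_top_of_ne_zero (hh : 5 < h) (hn : 2 ≤ n) (hk : k + 2 ≤ 2 * n + h) :
    ∃ s₀, ∀ s ≥ s₀, ∀ p : gammaVertices h k n, p.1.1 ≠ 0 →
      p ∉ top k (walks (Gamma h k n).Adj s) := by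
  obtain ⟨s₀, hs₀⟩ := eventually_radial_lt (show 3 ≤ h - 3 by omega) hn
  refine ⟨s₀, fun s hs p hp hmem => ?_⟩
  have hpos : ∀ q : gammaVertices h k n, position n q.1.2 ≤ n + 1 := by
    rintro ⟨⟨c, i⟩, hq⟩
    obtain ⟨-, h1, h2, -⟩ := mem_gammaVertices.1 hq
    simp only [position]
    split_ifs <;> omega
  have hpos' : 1 ≤ position n p.1.2 := by
    obtain ⟨⟨c, i⟩, hq⟩ := p
    obtain ⟨-, h1, h2, h3⟩ := mem_gammaVertices.1 hq
    simp only [position]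
    split_ifs
    · omega
    · have : i ≠ 0 := fun hi => hp (h3 hi)
      omega
  rw [top, Set.mem_ofPred_eq] at hmem
  -- All `2n + h - 2` vertices of component `0` are ahead; the lower bound on `n` makes this at
  -- least `k`.
  have hcard := card_le_ncard_of_subset
    (({0} : Finset ℕ) ×ˢ Finset.Icc (-(n : ℤ)) ((n : ℤ) + ((h : ℤ) - 3)))
    (G := gammaVertices h k n)
    (by
      rintro ⟨c, i⟩ hci
      rw [Finset.mem_product, Finset.mem_singleton, Finset.mem_Icc] at hci
      rw [mem_gammaVertices]
      simp only at hci
      omega)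
    {q | walks (Gamma h k n).Adj s p < walks (Gamma h k n).Adj s q}
    (by
      intro q hq
      rw [Finset.mem_product, Finset.mem_singleton] at hq
      rw [Set.mem_ofPred_eq, walks_eq_radial (by omega) hn, walks_eq_radial (by omega) hn,
        if_neg hp, if_pos hq.1]
      exact hs₀ s hs _ _ hpos' (hpos p) (hpos q))
  rw [Finset.card_product, Finset.card_singleton, Int.card_Icc] at hcard
  omega

/-- As long as the scores of the ends of the chains in the various components hardly differ, the
inner vertices of the chain in component `0` are not among the top `k`. -/
lemma notMem_top_of_inner {s : ℕ} (hh : 5 < h) (hr : 1 ≤ r)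
    (hs : radial (h - 3) (2 * r + 1) 1 (s + 1) (2 * r + 1) <
      4 / 3 * radial (h - 3) (2 * r + 1) 0 (s + 1) (2 * r + 1))
    (p : gammaVertices h k (2 * r + 1)) (hp : p.1.1 = 0) (hp' : p.1.2.natAbs < 2 * r + 1) :
    p ∉ top k (walks (Gamma h k (2 * r + 1)).Adj (s + 2)) := by
  intro hmem
  rw [top, Set.mem_ofPred_eq] at hmem
  have hm : 3 ≤ h - 3 := by omega
  have hp_le : walks (Gamma h k (2 * r + 1)).Adj (s + 2) p ≤
      3 / 2 * radial (h - 3) (2 * r + 1) 1 (s + 1) (2 * r + 1) := by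
    rw [walks_eq_radial (by omega) (by omega), if_pos hp, position, if_neg (by omega)]
    exact radial_succ_le hm hr s hp'
  have h0 := radial_end_pos (b := 1) hm hr zero_le_one (s + 1)
  have h2 := two_mul_radial_le (m := h - 3) (n := 2 * r + 1) (by omega) (by omega) (s + 1)
    (2 * r + 1) (by omega)
  -- `T₀` has `h - 1` elements and `T₁` has `ℓ(h - 3)`, together at least `k`.
  let T₀ : Finset (ℕ × ℤ) := {0} ×ˢ insert (-((2 * r + 1 : ℕ) : ℤ))
    (Finset.Icc ((2 * r + 1 : ℕ) : ℤ) (((2 * r + 1 : ℕ) : ℤ) + ((h : ℤ) - 3)))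
  let T₁ : Finset (ℕ × ℤ) := Finset.Icc 1 (copies h k) ×ˢ
    Finset.Ioc ((2 * r + 1 : ℕ) : ℤ) (((2 * r + 1 : ℕ) : ℤ) + ((h : ℤ) - 3))
  have hT₀ : ∀ c i, (c, i) ∈ T₀ ↔ c = 0 ∧ (i = -((2 * r + 1 : ℕ) : ℤ) ∨
      ((2 * r + 1 : ℕ) : ℤ) ≤ i ∧ i ≤ ((2 * r + 1 : ℕ) : ℤ) + ((h : ℤ) - 3)) := by
    intro c i
    simp only [T₀, Finset.mem_product, Finset.mem_singleton, Finset.mem_insert, Finset.mem_Icc]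
  have hT₁ : ∀ c i, (c, i) ∈ T₁ ↔ (1 ≤ c ∧ c ≤ copies h k) ∧
      ((2 * r + 1 : ℕ) : ℤ) < i ∧ i ≤ ((2 * r + 1 : ℕ) : ℤ) + ((h : ℤ) - 3) := by
    simp [T₁]
  have hcard := card_le_ncard_of_subset (T₀ ∪ T₁) (G := gammaVertices h k (2 * r + 1))
    (by
      rintro ⟨c, i⟩ hci
      rw [Finset.mem_union, hT₀, hT₁] at hci
      rw [mem_gammaVertices]
      omega)
    {q | walks (Gamma h k (2 * r + 1)).Adj (s + 2) p < walks (Gamma h k (2 * r + 1)).Adj (s + 2) q}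
    (by
      rintro ⟨⟨c, i⟩, hq⟩ hci
      refine hp_le.trans_lt ?_
      rw [walks_eq_radial (by omega) (by omega)]
      rw [Finset.mem_union, hT₀, hT₁] at hci
      simp only [position]
      rcases hci with ⟨rfl, hi⟩ | ⟨hc, hi⟩
      · rw [if_pos rfl]
        split_ifs with hlt
        · rw [radial_succ_top]
          linarith
        · rw [show i.natAbs = 2 * r + 1 by omega]
          linarith
      -- Each such vertex sees two ends, and twice the end value exceeds `2 * 3/4 = 3/2` of the end
      -- value in component `0`.
      · rw [if_neg (by omega), if_pos hi.1, radial_succ_top]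
        linarith)
  rw [Finset.card_union_of_disjoint, Finset.card_product, Finset.card_product,
    Finset.card_singleton, Finset.card_insert_of_notMem (by rw [Finset.mem_Icc]; omega),
    Int.card_Icc, Int.card_Ioc, Nat.card_Icc] at hcard
  · have h3 := le_copies_mul (k := k) (show 4 ≤ h by omega)
    have e1 : (((2 * r + 1 : ℕ) : ℤ) + ((h : ℤ) - 3) - ((2 * r + 1 : ℕ) : ℤ)).toNat = h - 3 := by
      omega
    have e2 : (((2 * r + 1 : ℕ) : ℤ) + ((h : ℤ) - 3) + 1 - ((2 * r + 1 : ℕ) : ℤ)).toNat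
        = h - 2 := by omega
    rw [e1, e2, Nat.add_sub_cancel] at hcard
    omega
  · rw [Finset.disjoint_left]
    rintro ⟨c, i⟩ h1 h2
    rw [hT₀] at h1
    rw [hT₁] at h2
    omega

/-- The two obstructions to convergence combined, for a sequence of score vectors that visits
the vectors of walk counts at the times `u t`. -/
lemma not_convergesIn (hh : 5 < h) (hr : 1 ≤ r) (hk : k + 2 ≤ 2 * (2 * r + 1) + h) {τ : ℕ}
    (hτ : (τ : ℝ) ≤ tBar h (2 * r + 1)) {x : ℕ → gammaVertices h k (2 * r + 1) → ℝ} {u : ℕ → ℕ}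
    (hu : ∀ t, 1 ≤ t → t ≤ u t)
    (hx : ∀ t, 1 ≤ t → SameRay (x t) (walks (Gamma h k (2 * r + 1)).Adj (u t)))
    (hq : ∃ t q e, 1 ≤ t ∧ τ ≤ t ∧ q ≤ max τ 1 ∧ e ≤ 1 ∧ 1 ≤ 2 * q + e ∧ u t = 2 * q + e + 1) :
    ¬ ConvergesIn x h k τ := by
  obtain ⟨s₀, hs₀⟩ := notMem_top_of_ne_zero (k := k) hh (show 2 ≤ 2 * r + 1 by omega) hk
  obtain ⟨t, q, e, ht1, htτ, hqτ, he, hqe, hut⟩ := hq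
  have hcomp := radial_compare_tBar hh hr hτ hqτ he
  obtain ⟨s, hs⟩ : ∃ s, 2 * q + e = s + 1 := ⟨2 * q + e - 1, by omega⟩
  rw [hs] at hcomp hut
  intro hconv
  rw [ConvergesIn] at hconv
  have hle := ncard_le_card_of_subset (({0} : Finset ℕ) ×ˢ insert (-((2 * r + 1 : ℕ) : ℤ))
    (Finset.Icc ((2 * r + 1 : ℕ) : ℤ) (((2 * r + 1 : ℕ) : ℤ) + ((h : ℤ) - 3))))
    (⋂ t ≥ τ, top k (x t)) (by
      intro p hp
      simp only [Set.mem_iInter] at hp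
      have hp0 : p.1.1 = 0 := by
        by_contra hne
        have h1 := hp (max τ (max 1 s₀)) (le_max_left _ _)
        rw [(hx _ (by omega)).top_eq] at h1
        refine hs₀ _ ?_ p hne h1
        have := hu (max τ (max 1 s₀)) (by omega)
        omega
      have hp1 : ¬ p.1.2.natAbs < 2 * r + 1 := by
        intro hlt
        have h1 := hp t htτ
        rw [(hx _ ht1).top_eq, hut] at h1
        exact notMem_top_of_inner hh hr hcomp p hp0 hlt h1
      obtain ⟨⟨c, i⟩, hq⟩ := p
      obtain ⟨-, h1, h2, -⟩ := mem_gammaVertices.1 hq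
      simp only at hp0 hp1
      simp only [Finset.mem_product, Finset.mem_singleton, Finset.mem_insert, Finset.mem_Icc]
      omega)
  rw [Finset.card_product, Finset.card_singleton,
    Finset.card_insert_of_notMem (by rw [Finset.mem_Icc]; omega), Int.card_Icc] at hle
  omega

lemma Admissible.exists_half {h k n : ℕ} (hA : Admissible h k n) :
    ∃ r, 1 ≤ r ∧ n = 2 * r + 1 ∧ k + 2 ≤ 2 * n + h := by
  obtain ⟨-, hk, ⟨r, hr⟩, hmax⟩ := hA
  have h1 : (3 : ℝ) ≤ n := (le_max_left _ _).trans hmax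
  have h2 := (le_max_right _ _).trans hmax
  have h3 : 3 ≤ n := by exact_mod_cast h1
  refine ⟨r, by omega, hr, ?_⟩
  have h4 : ((k + 2 : ℕ) : ℝ) ≤ ((2 * n + h : ℕ) : ℝ) := by
    push_cast
    linarith
  exact_mod_cast h4

theorem slow_convergence {h k n : ℕ} (hA : Admissible h k n) {τ : ℕ} (hτ : (τ : ℝ) ≤ tBar h n) :
    ¬ ConvergesIn (authority (Gamma h k n).Adj) h k τ ∧
    ¬ ConvergesIn (hub (Gamma h k n).Adj) h k τ ∧
    ¬ ConvergesIn (halfSteps (Gamma h k n).Adj) h k τ := by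
  obtain ⟨r, hr, rfl, hk⟩ := hA.exists_half
  have hh : 5 < h := hA.1
  have hsymm : ∀ p q, (Gamma h k (2 * r + 1)).Adj p q → (Gamma h k (2 * r + 1)).Adj q p :=
    fun p q hpq => hpq.symm
  have hadj := exists_adj (h := h) (k := k) (n := 2 * r + 1) (by omega) (by omega)
  have : Nonempty (gammaVertices h k (2 * r + 1)) :=
    ⟨⟨(0, 0), mem_gammaVertices.2 (by omega)⟩⟩
  refine ⟨?_, ?_, ?_⟩
  -- The test time must give a walk length of at least `2`, hence `max τ 2` here but `max τ 1` for
  -- hubs.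
  · refine not_convergesIn hh hr hk hτ (u := fun t => 2 * t - 1) (fun t ht => by omega) ?_
      ⟨max τ 2, max τ 2 - 1, 0, by omega, by omega, by omega, by omega, by omega, by omega⟩
    intro t ht
    obtain ⟨t, rfl⟩ : ∃ a, t = a + 1 := ⟨t - 1, by omega⟩
    exact (sameRay_hub hsymm hadj t).2
  · exact not_convergesIn hh hr hk hτ (u := fun t => 2 * t) (fun t ht => by omega)
      (fun t _ => (sameRay_hub hsymm hadj t).1)
      ⟨max τ 1, max τ 1 - 1, 1, by omega, by omega, by omega, by omega, by omega, by omega⟩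
  · exact not_convergesIn hh hr hk hτ (u := fun t => t) (fun _ _ => le_rfl)
      (fun t _ => sameRay_halfSteps hsymm hadj t)
      ⟨max τ 2, (max τ 2 - 1) / 2, (max τ 2 - 1) % 2, by omega, by omega, by omega, by omega,
        by omega, by omega⟩

end SlowConvergence

/-! ### Growth of the lower bound -/

section Growth

variable {h k n : ℕ}

lemma one_div_sq_le_tBar_const :
    (6 : ℝ) ^ (-2 : ℝ) ≤ 3 * Real.log (7 / 6) / (4 * Real.exp 1) := by
  have h1 : 1 - (7 / 6 : ℝ)⁻¹ ≤ Real.log (7 / 6) := Real.one_sub_inv_le_log_of_pos (by norm_num)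
  have h2 := Real.exp_one_lt_d9
  rw [Real.rpow_neg (by norm_num), le_div_iff₀ (by positivity)]
  norm_num at h1 ⊢
  linarith

lemma rpow_le_half_sub (hh : 5 < h) : (h : ℝ) ^ (1 / 5 : ℝ) ≤ ((h : ℝ) - 3) / 2 := by
  have hh' : (6 : ℝ) ≤ h := by exact_mod_cast hh
  have h1 : (h : ℝ) / 4 ≤ ((h : ℝ) - 3) / 2 := by linarith
  refine le_trans ?_ h1
  have h2 : (h : ℝ) ≤ ((h : ℝ) / 4) ^ 5 := by
    have : (6 : ℝ) ^ 4 ≤ (h : ℝ) ^ 4 := by gcongr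
    nlinarith
  calc (h : ℝ) ^ (1 / 5 : ℝ) ≤ (((h : ℝ) / 4) ^ 5) ^ (1 / 5 : ℝ) := by gcongr
    _ = (h : ℝ) / 4 := by
      rw [← Real.rpow_natCast, ← Real.rpow_mul (by positivity)]
      norm_num

/-- The constant costs at most `h ^ 2`, and the base `(h - 3) / 2` is at least `h ^ (1/5)`. -/
lemma rpow_le_tBar (hh : 5 < h) (hn : 1 ≤ n) :
    (h : ℝ) ^ (((n : ℝ) - 1) / 10 - 2) ≤ tBar h n := by
  have hh' : (6 : ℝ) ≤ h := by exact_mod_cast hh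
  have hn' : (1 : ℝ) ≤ n := by exact_mod_cast hn
  have h0 : (0 : ℝ) < h := by linarith
  rw [sub_eq_add_neg, Real.rpow_add h0, tBar, mul_comm]
  refine mul_le_mul ?_ ?_ (by positivity) ?_
  · refine le_trans ?_ one_div_sq_le_tBar_const
    rw [Real.rpow_neg h0.le, Real.rpow_neg (by norm_num)]
    gcongr
  · calc (h : ℝ) ^ (((n : ℝ) - 1) / 10) = ((h : ℝ) ^ (1 / 5 : ℝ)) ^ (((n : ℝ) - 1) / 2) := by
          rw [← Real.rpow_mul h0.le]; congr 1; ring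
      _ ≤ _ := Real.rpow_le_rpow (by positivity) (rpow_le_half_sub hh) (by linarith)
  · have := Real.log_pos (show (1 : ℝ) < 7 / 6 by norm_num)
    positivity

/-- If `x` is at most linear in `n`, then `tBar` is at least exponential in `x`. -/
lemma rpow_le_tBar_of_le {K x : ℝ} (hK : 0 < K) (hh : 5 < h) (hn : 42 ≤ n) (hx : x ≤ K * n) :
    (h : ℝ) ^ (1 / (20 * K) * x) ≤ tBar h n := by
  have hh' : (6 : ℝ) ≤ h := by exact_mod_cast hh
  have hn' : (42 : ℝ) ≤ n := by exact_mod_cast hn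
  refine le_trans (Real.rpow_le_rpow_of_exponent_le (by linarith) ?_) (rpow_le_tBar hh (by omega))
  calc 1 / (20 * K) * x ≤ 1 / (20 * K) * (K * n) := by gcongr
    _ = n / 20 := by field_simp
    -- `(n - 1) / 10 - 2 ≥ n / 20` is exactly `n ≥ 42`.
    _ ≤ _ := by linarith

lemma numVertices_mul_div_le (hA : Admissible h k n) :
    (numVertices h k n : ℝ) * h / k ≤ 9 * n + 4 * h := by
  obtain ⟨hh, hk, -, hmax⟩ := hA
  have hh' : (6 : ℝ) ≤ h := by exact_mod_cast hh
  have hk' : (h : ℝ) < k := by exact_mod_cast hk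
  have hn : (3 : ℝ) ≤ n := (le_max_left _ _).trans hmax
  have h0 : (0 : ℝ) < (h : ℝ) - 3 := by linarith
  -- The ceiling costs at most `1`, giving `2k / (h - 3)`, and `h ≤ 2(h - 3)`.
  have hceil : (⌈((k : ℝ) - 2) / ((h : ℝ) - 3)⌉₊ : ℝ) * h ≤ 4 * k := by
    have h1 := (Nat.ceil_lt_add_one (a := ((k : ℝ) - 2) / ((h : ℝ) - 3))
      (div_nonneg (by linarith) h0.le)).le
    have h2 : ((k : ℝ) - 2) / ((h : ℝ) - 3) + 1 ≤ 2 * k / ((h : ℝ) - 3) := by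
      rw [div_add_one h0.ne']
      gcongr
      linarith
    have h3 : 2 * (k : ℝ) / ((h : ℝ) - 3) * h ≤ 4 * k := by
      rw [div_mul_eq_mul_div, div_le_iff₀ h0]
      nlinarith
    exact (mul_le_mul_of_nonneg_right (h1.trans h2) (by linarith)).trans h3
  have hsub : ((2 * n + h - 3 : ℕ) : ℝ) = 2 * n + h - 3 := by
    rw [Nat.cast_sub (by omega)]; push_cast; ring
  rw [div_le_iff₀ (by linarith), numVertices]
  push_cast [hsub]
  calc ((⌈((k : ℝ) - 2) / ((h : ℝ) - 3)⌉₊ : ℝ) * (2 * n + h - 3) + 1) * h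
      = ((⌈((k : ℝ) - 2) / ((h : ℝ) - 3)⌉₊ : ℝ) * h) * (2 * n + h - 3) + h := by ring
    _ ≤ 4 * k * (2 * n + h - 3) + h := by gcongr; linarith
    _ ≤ _ := by nlinarith

lemma lt_of_numVertices_lt {n' : ℕ}
    (hn : numVertices h k n' < numVertices h k n) : n' < n := by
  by_contra! hle
  refine absurd hn (not_lt.2 ?_)
  rw [numVertices, numVertices]
  gcongr

/-- If `k` exceeds `h` or the number of vertices exceeds `2 k` by a constant factor, then
`h` is at most linear in `n`. -/
lemma mul_le_of_gap (hA : Admissible h k n) {ε : ℝ} (hε : 0 < ε)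
    (hor : (1 + ε) * h ≤ k ∨ (2 + ε) * k ≤ numVertices h k n) :
    min ε (1 / 2) * h ≤ 4 * n := by
  obtain ⟨hh, hk, -, hmax⟩ := hA
  have hh' : (6 : ℝ) ≤ h := by exact_mod_cast hh
  have hk' : (h : ℝ) < k := by exact_mod_cast hk
  have h2 := (le_max_right _ _).trans hmax
  have hn : (3 : ℝ) ≤ n := (le_max_left _ _).trans hmax
  have m1 := mul_le_mul_of_nonneg_right (min_le_left ε (1 / 2)) (show (0 : ℝ) ≤ h by linarith)
  have m2 := mul_le_mul_of_nonneg_right (min_le_right ε (1 / 2)) (show (0 : ℝ) ≤ h by linarith)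
  rcases hor with hor | hor
  · linarith
  -- If `k` is close to `2h` or larger, admissibility already gives `h - 1 ≤ 2n`. Otherwise the
  -- ceiling is at most `2`, so `N ≤ 4n + 2h`, and `(2 + ε)k ≤ N` with `k > h` leaves `εh ≤ 4n`.
  by_cases hbig : 2 * h ≤ k + 3
  · have hbig' : 2 * (h : ℝ) ≤ k + 3 := by exact_mod_cast hbig
    linarith
  · have hbig' : (k : ℝ) + 4 ≤ 2 * h := by exact_mod_cast (by omega : k + 4 ≤ 2 * h)
    have hceil : ⌈((k : ℝ) - 2) / ((h : ℝ) - 3)⌉₊ ≤ 2 := by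
      rw [Nat.ceil_le, div_le_iff₀ (by linarith)]
      push_cast
      linarith
    have hN : numVertices h k n ≤ 2 * (2 * n + h - 3) + 1 := by
      rw [numVertices]; gcongr
    have hN' : (numVertices h k n : ℝ) ≤ 4 * n + 2 * h := by
      exact_mod_cast hN.trans (by omega : 2 * (2 * n + h - 3) + 1 ≤ 4 * n + 2 * h)
    nlinarith

end Growth

end HITS

theorem theorem1 :
    (∀ h k n : ℕ, HITS.Admissible h k n →
      Fintype.card (HITS.gammaVertices h k n) = HITS.numVertices h k n ∧
      ∀ τ : ℕ, (τ : ℝ) ≤ HITS.tBar h n →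
        ¬ HITS.ConvergesIn (HITS.authority (HITS.Gamma h k n).Adj) h k τ ∧
        ¬ HITS.ConvergesIn (HITS.hub (HITS.Gamma h k n).Adj) h k τ ∧
        ¬ HITS.ConvergesIn (HITS.halfSteps (HITS.Gamma h k n).Adj) h k τ) ∧
    (∃ c : ℝ, 0 < c ∧ ∃ n₀ : ℕ, ∀ h k n : ℕ, HITS.Admissible h k n → n₀ ≤ n →
      (h : ℝ) ^ (c * n) ≤ HITS.tBar h n) ∧
    (∃ c : ℝ, 0 < c ∧ ∀ h k : ℕ, ∃ N₀ : ℕ, ∀ n : ℕ, HITS.Admissible h k n →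
      2 * k ≤ HITS.numVertices h k n → N₀ ≤ HITS.numVertices h k n →
      (h : ℝ) ^ (c * (HITS.numVertices h k n * h / k)) ≤ HITS.tBar h n) ∧
    (∀ ε : ℝ, 0 < ε → ∃ c : ℝ, 0 < c ∧ ∃ n₀ : ℕ, ∀ h k n : ℕ, HITS.Admissible h k n → n₀ ≤ n →
      2 * k ≤ HITS.numVertices h k n →
      ((1 + ε) * h ≤ k ∨ (2 + ε) * k ≤ HITS.numVertices h k n) →
      (h : ℝ) ^ (c * (HITS.numVertices h k n * h / k)) ≤ HITS.tBar h n) := by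
  refine ⟨fun h k n hA => ⟨?_, fun τ hτ => HITS.slow_convergence hA hτ⟩, ?_, ?_, ?_⟩
  · exact HITS.card_gammaVertices (by have := hA.1; omega) hA.2.1.le
  · exact ⟨1 / (20 * 1), by norm_num, 42, fun h k n hA hn =>
      HITS.rpow_le_tBar_of_le one_pos hA.1 hn (by rw [one_mul])⟩
  -- This `N₀` forces `n > max 42 h`, so `9n + 4h ≤ 13n`.
  · refine ⟨1 / (20 * 13), by norm_num, fun h k =>
      ⟨HITS.numVertices h k (max 42 h) + 1, fun n hA _ hN => ?_⟩⟩
    have hn := HITS.lt_of_numVertices_lt (h := h) (k := k) (n := n) (n' := max 42 h) (by omega)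
    refine HITS.rpow_le_tBar_of_le (by norm_num) hA.1 (by omega) ?_
    have h1 := HITS.numVertices_mul_div_le hA
    have h2 : (h : ℝ) ≤ n := by exact_mod_cast (by omega : h ≤ n)
    linarith
  · intro ε hε
    have hδ : 0 < min ε (1 / 2) := lt_min hε (by norm_num)
    refine ⟨1 / (20 * (9 + 16 / min ε (1 / 2))), by positivity, 42, fun h k n hA hn _ hor => ?_⟩
    refine HITS.rpow_le_tBar_of_le (by positivity) hA.1 hn ?_
    have h1 := HITS.numVertices_mul_div_le hA
    have h2 : (h : ℝ) ≤ 4 * n / min ε (1 / 2) := by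
      rw [le_div_iff₀ hδ, mul_comm]
      exact HITS.mul_le_of_gap hA hε hor
    calc _ ≤ 9 * (n : ℝ) + 4 * (4 * n / min ε (1 / 2)) := by linarith
      _ = _ := by ring
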